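/- Let $(M,g)$ be a smooth $n$-dimensional Riemannian manifold and let $\phi:M\to\mathbb{R}$ be a smooth function with $d\phi\neq 0$ at every point of $\Gamma=\{\phi=0\}$. Put $\Omega=\{\phi>0\}$, let $G=g/\phi$ be the corresponding Riemannian metric on $\Omega$, and let $H(x,p)=\phi(x)\,\|p\|_g^2$ on $T^*M$, where $\|\cdot\|_g$ is the norm on covectors induced by $g$. Cotangent bundles carry the standard symplectic form $dp\wedge dx$. Let $$\hat\Omega=\{(x,\xi)\in M\times\mathbb{R}:\ \xi^2=2\phi(x)\},\qquad \pi:\hat\Omega\to M,\quad \pi(x,\xi)=x,\qquad \hat\Gamma=\pi^{-1}(\Gamma).$$ Then $\hat\Omega$ is a smooth embedded $n$-dimensional submanifold of $M\times\mathbb{R}$; topologically it is the double of $\overline\Omega$, i.e. there is a homeomorphism, compatible with the projections to $\overline\Omega$, from two copies of $\overline\Omega$ glued along $\Gamma$ onto $\hat\Omega$. Moreover: 1. The map $\pi$ is smooth and $\pi(\hat\Omega)=\overline\Omega$. Over $\Omega$ it is a smooth double covering, that is, a covering map and a local diffeomorphism with two-point fibres. The sets $\Gamma\subset M$ and $\hat\Gamma\subset\hat\Omega$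 are smooth embedded hypersurfaces, and $\pi$ restricts to a diffeomorphism $\hat\Gamma\to\Gamma$. 2. For $y\in\hat\Omega\setminus\hat\Gamma$ one has $\pi(y)\in\Omega$ and $d\pi(y)$ is invertible, so that $\Pi(y,p_y)=(\pi(y),(d\pi(y)^*)^{-1}p_y)$ is a well-defined map $\Pi:T^*(\hat\Omega\setminus\hat\Gamma)\to T^*\Omega$. The function $H\circ\Pi$ extends to a smooth function $\hat H$ on $T^*\hat\Omega$ (the Levi-Civita regularization of $H$). 3. Along every trajectory of the Hamiltonian system on $T^*\hat\Omega$ with Hamiltonian $\hat H$, at the times when it is not over $\hat\Gamma$, the map $\Pi$ takes it to a trajectory of the Hamiltonian system on $T^*\Omega$ with Hamiltonian $H$, and its projection to $\Omega$ is an affinely parametrized (possibly constant) geodesic of $G$. 4. For every $h>0$ the level set $\{\hat H=h\}$ is a smooth embedded hypersurface of $T^*\hat\Omega$, the section $$\mathcal{S}_h=\{(y,p_y)\in T^*\hat\Omega:\ y\in\hat\Gamma\}\cap\{\hat H=h\}$$ is a smooth embedded submanifold of dimension $2n-2$ (if it is non-empty), and trajectories cross $\mathcal{S}_h$ transversely in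 $\{\hat H=h\}$: at each $z\in\mathcal{S}_h$ the Hamiltonian vector $X_{\hat H}(z)$ satisfies $T_z\{\hat H=h\}=T_z\mathcal{S}_h\oplus\mathbb{R}X_{\hat H}(z)$. -/

import Mathlib

open scoped Manifold ContDiff Topology

noncomputable section

namespace LeviCivitaRegularization

/-- The model space `ℝᵏ` with its Euclidean norm. -/
abbrev ES (k : ℕ) : Type := EuclideanSpace ℝ (Fin k)

section Cotangent

variable (n : ℕ) (N : Type*) [TopologicalSpace N] [ChartedSpace (ES n) N]
  [IsManifold (𝓡 n) ∞ N]

/-- The total space of the cotangent bundle `T*N`, with Mathlib's bundle topology and charts. -/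
abbrev Cotangent : Type _ :=
  Bundle.TotalSpace (ES n →L[ℝ] ℝ)
    (fun x : N => TangentSpace (𝓡 n) x →L[ℝ] Bundle.Trivial N ℝ x)

/-- The model with corners of the `2n`-dimensional manifold `T*N`. -/
abbrev cotangentModel :
    ModelWithCorners ℝ (ES n × (ES n →L[ℝ] ℝ)) (ModelProd (ES n) (ES n →L[ℝ] ℝ)) :=
  (𝓡 n).prod 𝓘(ℝ, ES n →L[ℝ] ℝ)

variable {n N}

/-- The Hamiltonian vector field of `H` for the standard symplectic form `dp ∧ dx` on `T*N`:
`ẋ = ∂H/∂p`, `ṗ = -∂H/∂x`. The components are taken in the preferred chart of `T*N` at `z`,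
which is the cotangent lift `(x, p)` of the preferred chart of `N` at the base point of `z`, hence
a system of canonical coordinates. -/
def hamiltonianField (H : Cotangent n N → ℝ) (z : Cotangent n N) :
    TangentSpace (cotangentModel n) z :=
  let dH : (ES n × (ES n →L[ℝ] ℝ)) →L[ℝ] ℝ := mfderiv (cotangentModel n) 𝓘(ℝ, ℝ) H z
  ((WithLp.toLp 2 fun i => dH (0, EuclideanSpace.proj i),
    -(dH.comp (ContinuousLinearMap.inl ℝ (ES n) (ES n →L[ℝ] ℝ)))) :
      ES n × (ES n →L[ℝ] ℝ))

/-- `z` is a trajectory, over the open set of times `J`, of the Hamiltonian system on `T*N` with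
Hamiltonian `H`. -/
def IsTrajectoryOn (H : Cotangent n N → ℝ) (z : ℝ → Cotangent n N) (J : Set ℝ) : Prop :=
  IsOpen J ∧ IsMIntegralCurveOn (I := cotangentModel n) z (hamiltonianField H) J

/-- The squared norm `⟨A(x)⁻¹ p, p⟩` of a covector for the Riemannian metric `g = ⟨A dx, dx⟩`;
`g.inner x` is the (invertible) map `v ↦ g(v, ·)` from tangent vectors to covectors. -/
def conormSq (g : Bundle.ContMDiffRiemannianMetric (𝓡 n) ∞ (ES n)
      (fun x : N => TangentSpace (𝓡 n) x))
    (z : Cotangent n N) : ℝ :=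
  let p : TangentSpace (𝓡 n) z.proj →L[ℝ] ℝ := z.snd
  p ((g.inner z.proj).inverse p)

/-- The Hamiltonian `H(x, p) = φ(x) ‖p‖²_g`. -/
def hamiltonian (g : Bundle.ContMDiffRiemannianMetric (𝓡 n) ∞ (ES n)
      (fun x : N => TangentSpace (𝓡 n) x))
    (φ : N → ℝ) (z : Cotangent n N) : ℝ :=
  φ z.proj * conormSq g z

/-- The cotangent lift `(y, p) ↦ (f y, (df(y)*)⁻¹ p)` of a map `f`, where
`(df(y)*)⁻¹ p = p ∘ df(y)⁻¹`. It is meaningful at the points where `df(y)` is invertible. -/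
def cotangentLift {M : Type*} [TopologicalSpace M] [ChartedSpace (ES n) M]
    [IsManifold (𝓡 n) ∞ M] (f : N → M) (z : Cotangent n N) : Cotangent n M :=
  let p : TangentSpace (𝓡 n) z.proj →L[ℝ] ℝ := z.snd
  ⟨f z.proj, p.comp (mfderiv (𝓡 n) (𝓡 n) f z.proj).inverse⟩

end Cotangent

section Geodesic

variable {n : ℕ} {M : Type*} [TopologicalSpace M] [ChartedSpace (ES n) M]

/-- The metric `G = g / φ`, a Riemannian metric on `{φ > 0}`. -/
def conformalMetric [IsManifold (𝓡 n) ∞ M]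
    (g : Bundle.ContMDiffRiemannianMetric (𝓡 n) ∞ (ES n)
      (fun x : M => TangentSpace (𝓡 n) x))
    (φ : M → ℝ) (x : M) : TangentSpace (𝓡 n) x →L[ℝ] TangentSpace (𝓡 n) x →L[ℝ] ℝ :=
  (φ x)⁻¹ • g.inner x

variable (B : ∀ x : M, TangentSpace (𝓡 n) x →L[ℝ] TangentSpace (𝓡 n) x →L[ℝ] ℝ)

/-- The coefficients of the metric `B`, at the point with coordinates `u`, in the preferred chart
around `x₀`. -/
def metricInChart (x₀ : M) (v w : ES n) (u : ES n) : ℝ :=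
  B ((extChartAt (𝓡 n) x₀).symm u)
    (mfderiv 𝓘(ℝ, ES n) (𝓡 n) (extChartAt (𝓡 n) x₀).symm u v)
    (mfderiv 𝓘(ℝ, ES n) (𝓡 n) (extChartAt (𝓡 n) x₀).symm u w)

/-- The Christoffel symbol of the first kind
`Γ(a, b; w) = ½ (∂ₐ B(b, w) + ∂_b B(a, w) - ∂_w B(a, b))` of the metric `B`, in the preferred chart
around `x₀`. -/
def christoffelFirst (x₀ : M) (a b w : ES n) (u : ES n) : ℝ :=
  (fderiv ℝ (metricInChart B x₀ b w) u a + fderiv ℝ (metricInChart B x₀ a w) u b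
    - fderiv ℝ (metricInChart B x₀ a b) u w) / 2

/-- `c` is a (possibly constant, affinely parametrized) geodesic of the metric `B` over the open
set of times `J`: it is `C²` and satisfies the geodesic equation `∇_{ċ} ċ = 0`, paired here with an
arbitrary vector `w`. At each time `t` the equation is written in the preferred chart at `c t`. -/
def IsGeodesicOn (c : ℝ → M) (J : Set ℝ) : Prop :=
  IsOpen J ∧ ContMDiffOn 𝓘(ℝ, ℝ) (𝓡 n) 2 c J ∧
    ∀ t ∈ J, ∀ w : ES n,
      let x : ℝ → ES n := fun s => extChartAt (𝓡 n) (c t) (c s)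
      metricInChart B (c t) (deriv (deriv x) t) w (x t)
        + christoffelFirst B (c t) (deriv x t) (deriv x t) w (x t) = 0

end Geodesic

section Submanifold

variable {F H N : Type*} [NormedAddCommGroup F] [NormedSpace ℝ F] [TopologicalSpace H]
  [TopologicalSpace N] [ChartedSpace H N]

/-- The given charts on the subset `S` (with the subspace topology) make it a smooth embedded
`k`-dimensional submanifold of `N`. -/
structure IsEmbeddedSubmanifold (I : ModelWithCorners ℝ F H) (k : ℕ) (S : Set N)
    [ChartedSpace (ES k) S] : Prop where
  isManifold : IsManifold (𝓡 k) ∞ S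
  isSmoothEmbedding : Manifold.IsSmoothEmbedding (𝓡 k) I ∞ (Subtype.val : S → N)

/-- The tangent space `T_z S ⊆ T_z N` of an embedded submanifold `S ⊆ N`. -/
def submanifoldTangent (I : ModelWithCorners ℝ F H) (k : ℕ) (S : Set N)
    [ChartedSpace (ES k) S] (z : S) : Submodule ℝ (TangentSpace I (z : N)) :=
  LinearMap.range (mfderiv (𝓡 k) I (Subtype.val : S → N) z).toLinearMap

end Submanifold

/-- Gluing two copies of `A` along `C`: the points `(x, false)` and `(x, true)` are identified
exactly if `x ∈ C`. -/
def doubleSetoid {M : Type*} (A C : Set M) : Setoid (A × Bool) where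
  r a b := a = b ∨ (a.1 = b.1 ∧ (a.1 : M) ∈ C)
  iseqv :=
    { refl := fun _ => Or.inl rfl
      symm := by
        rintro a b (h | ⟨h, h'⟩)
        · exact Or.inl h.symm
        · exact Or.inr ⟨h.symm, h ▸ h'⟩
      trans := by
        rintro a b c (h | ⟨h, h'⟩) (k | ⟨k, k'⟩)
        · exact Or.inl (h.trans k)
        · exact Or.inr ⟨h ▸ k, h ▸ k'⟩
        · exact Or.inr ⟨k ▸ h, h'⟩
        · exact Or.inr ⟨h.trans k, h'⟩ }

/-- The double of `A` along `C`, with the quotient topology. -/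
abbrev Double {M : Type*} (A C : Set M) : Type _ := Quotient (doubleSetoid A C)

section Regularization

variable {M : Type*} (φ : M → ℝ)

/-- The domain `Ω = {φ > 0}`. -/
def domain : Set M := {x | 0 < φ x}

/-- The boundary `Γ = {φ = 0}`. -/
def boundary : Set M := {x | φ x = 0}

/-- The regularized configuration space `Ω̂ = {(x, ξ) ∈ M × ℝ : ξ² = 2 φ(x)}`. -/
def regularized : Set (M × ℝ) := {y | y.2 ^ 2 = 2 * φ y.1}

/-- The projection `π : Ω̂ → M`, `(x, ξ) ↦ x`. -/
def proj (y : regularized φ) : M := y.1.1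

/-- `Γ̂ = π⁻¹(Γ)`. -/
def liftedBoundary : Set (regularized φ) := proj φ ⁻¹' boundary φ

/-- The section `S_h = {(y, p) ∈ T*Ω̂ : y ∈ Γ̂} ∩ {Ĥ = h}`. -/
def poincareSection {n : ℕ} [TopologicalSpace M] [ChartedSpace (ES n) (regularized φ)]
    [IsManifold (𝓡 n) ∞ (regularized φ)] (Hhat : Cotangent n (regularized φ) → ℝ) (h : ℝ) :
    Set (Cotangent n (regularized φ)) :=
  {z | z.proj ∈ liftedBoundary φ} ∩ {z | Hhat z = h}

end Regularization

end LeviCivitaRegularization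

end

/-! The equation `ξ² = 2φ` cuts out a smooth hypersurface of `M × ℝ`, because `2ξ dξ - 2 dφ`
vanishes nowhere on it: where `ξ = 0` one is over `Γ`, and there `dφ ≠ 0`. The proof fixes
particular charts. Around `(x₀, ξ₀)` the coordinates are `ψ(x) + ξ v`, with `ψ` the preferred chart
of `M` at `x₀`, `v = 0` if `ξ₀ ≠ 0`, and `dφ(v) = 1` if `ξ₀ = 0` (`exists_adaptedCharts`). Since a
tangent space is read in the preferred chart at its own point, `dπ(a) + dξ(a) v = a`; off `Γ̂` both
`dπ` and the lift `Π` then become identities in coordinates.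

For `w` tangent to `M` at `π(y)`, the pair `(ξ w, dφ(w))` is tangent to `Ω̂`, since `ξ · dφ(w) =
dφ(ξ w)`; its coordinate vector is `ξ w + dφ(w) v`. Pairing a covector `p` with this lift gives a
covector `ξ p + p(v) dφ` on `M` that depends smoothly on `(y, p)`, also across `Γ̂`. Put `Ĥ = ½ ‖ξ p
+ p(v) dφ‖²_g`. Off `Γ̂` this is `½ ξ² ‖p‖² = φ ‖p‖²`, that is `H ∘ Π` (`regHamiltonian_eq`);
smoothness comes from `regCovec_comp_dchartSymm`.

Off `Γ̂` the differentials of `Ĥ` and `H` therefore agree in canonical coordinates, and so do the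
Hamiltonian fields. Now `H` is the quadratic form dual to `G = g/φ`, so its trajectories satisfy `G
ẋ = 2P` and `2 Ṗ(w) = ½ (∂_w G)(ẋ, ẋ)`; differentiating the first relation gives the geodesic
equation. The field `hamiltonianField` is defined pointwise in a chart that varies with the point,
so working in one fixed chart requires that changes of canonical charts be symplectic, which rests
on the symmetry of second derivatives.

`Ĥ` is quadratic in `p`, so Euler's identity `dĤ(0, p) = 2Ĥ` makes positive levels regular. Over
`Γ̂` one has `Ĥ = ½ p(v)² ‖dφ‖²` and `ξ̇ = p(v) ‖dφ‖²`, hence `ξ̇ · p(v) = 2Ĥ > 0`. So the flow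
crosses `{ξ = 0}` with nonzero speed, and `(ξ, Ĥ)` has surjective differential along `S_h`; the
regular level set theorem and linear algebra finish the proof. -/

noncomputable section

namespace LeviCivitaRegularization

/-! ### Submanifold structures from slice charts -/

section Slice

variable {E H N : Type*} [NormedAddCommGroup E] [NormedSpace ℝ E] [TopologicalSpace H]
  [TopologicalSpace N] [ChartedSpace H N] {I : ModelWithCorners ℝ E H}
  {F : Type*} [NormedAddCommGroup F] [NormedSpace ℝ F] {k : ℕ} {S : Set N}

/-- A smooth chart of `N` with values in `ℝᵏ × F` in which `S` is the slice `ℝᵏ × {0}`. -/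
structure SliceChart (I : ModelWithCorners ℝ E H) (k : ℕ) (F : Type*) [NormedAddCommGroup F]
    [NormedSpace ℝ F] (S : Set N) where
  toHomeo : OpenPartialHomeomorph N (ES k × F)
  contMDiffOn : ContMDiffOn I 𝓘(ℝ, ES k × F) ∞ toHomeo toHomeo.source
  contMDiffOn_symm : ContMDiffOn 𝓘(ℝ, ES k × F) I ∞ toHomeo.symm toHomeo.target
  mem_iff : ∀ x ∈ toHomeo.source, x ∈ S ↔ (toHomeo x).2 = 0

namespace SliceChart

variable (c : SliceChart I k F S)

lemma symm_mem {u : ES k} (hu : (u, (0 : F)) ∈ c.toHomeo.target) : c.toHomeo.symm (u, 0) ∈ S :=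
  (c.mem_iff _ (c.toHomeo.map_target hu)).2 (by rw [c.toHomeo.right_inv hu])

open Classical in
/-- The chart of `S` induced by a slice chart. -/
def chart (z : S) : OpenPartialHomeomorph S (ES k) where
  toFun w := (c.toHomeo w).1
  -- The point `z` only serves as the value off the target; it supplies an element of `S`.
  invFun u := if hu : (u, (0 : F)) ∈ c.toHomeo.target then ⟨_, c.symm_mem hu⟩ else z
  source := Subtype.val ⁻¹' c.toHomeo.source
  target := {u | (u, (0 : F)) ∈ c.toHomeo.target}
  map_source' w hw := by
    have h := c.toHomeo.map_source hw
    have h2 := (c.mem_iff _ hw).1 w.2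
    change ((c.toHomeo w).1, (0 : F)) ∈ c.toHomeo.target
    rwa [← h2]
  map_target' u hu := by
    have hu' : (u, (0 : F)) ∈ c.toHomeo.target := hu
    simp [hu', c.toHomeo.map_target hu']
  left_inv' w hw := by
    have h := c.toHomeo.map_source hw
    have h2 := (c.mem_iff _ hw).1 w.2
    have h3 : ((c.toHomeo w).1, (0 : F)) = c.toHomeo w := by rw [← h2]
    apply Subtype.ext
    simp [h3, h, c.toHomeo.left_inv hw]
  right_inv' u hu := by
    have hu' : (u, (0 : F)) ∈ c.toHomeo.target := hu
    simp [hu', c.toHomeo.right_inv hu']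
  open_source := c.toHomeo.open_source.preimage continuous_subtype_val
  open_target := c.toHomeo.open_target.preimage (by fun_prop)
  continuousOn_toFun := continuous_fst.comp_continuousOn
    (c.toHomeo.continuousOn.comp continuous_subtype_val.continuousOn fun _ h => h)
  continuousOn_invFun := by
    rw [Topology.IsInducing.subtypeVal.continuousOn_iff]
    refine (c.toHomeo.continuousOn_symm.comp (f := fun u : ES k => (u, (0 : F)))
      (by fun_prop) fun u hu => hu).congr fun u hu => ?_
    have hu' : (u, (0 : F)) ∈ c.toHomeo.target := hu
    simp [hu']

@[simp] lemma chart_source (z : S) : (c.chart z).source = Subtype.val ⁻¹' c.toHomeo.source := rfl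

@[simp] lemma chart_apply (z w : S) : c.chart z w = (c.toHomeo w).1 := rfl

lemma mem_chart_target {z : S} {u : ES k} :
    u ∈ (c.chart z).target ↔ (u, (0 : F)) ∈ c.toHomeo.target := Iff.rfl

lemma coe_chart_symm {z : S} {u : ES k} (hu : (u, (0 : F)) ∈ c.toHomeo.target) :
    ((c.chart z).symm u : N) = c.toHomeo.symm (u, 0) := by
  have h : (c.chart z).symm u = ⟨_, c.symm_mem hu⟩ := dif_pos hu
  rw [h]

end SliceChart

variable (c : S → SliceChart I k F S) (hc : ∀ z, (z : N) ∈ (c z).toHomeo.source)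

/-- The charts on `S` induced by a family of slice charts. -/
abbrev chartedSpaceOfSlices : ChartedSpace (ES k) S where
  atlas := Set.range fun z => (c z).chart z
  chartAt z := (c z).chart z
  mem_chart_source := hc
  chart_mem_atlas z := ⟨z, rfl⟩

-- A change of charts of `S` is a change of slice charts of `N`, restricted to `ℝᵏ × {0}` and
-- followed by the projection to `ℝᵏ`, hence smooth.
include hc in
lemma isManifold_chartedSpaceOfSlices :
    @IsManifold ℝ _ (ES k) _ _ (ES k) _ (𝓡 k) ∞ S _ (chartedSpaceOfSlices c hc) := by
  let := chartedSpaceOfSlices c hc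
  refine isManifold_of_contDiffOn (𝓡 k) ∞ S ?_
  rintro _ _ ⟨z, rfl⟩ ⟨w, rfl⟩
  have key : ContMDiffOn 𝓘(ℝ, ES k) 𝓘(ℝ, ES k × F) ∞
      (fun u : ES k => (c w).toHomeo ((c z).toHomeo.symm (u, 0)))
      (((c z).chart z).symm ≫ₕ ((c w).chart w)).source := by
    refine (c w).contMDiffOn.comp ((c z).contMDiffOn_symm.comp (t := (c z).toHomeo.target)
      (f := fun u : ES k => (u, (0 : F))) (ContDiff.contMDiff (by fun_prop)).contMDiffOn ?_) ?_
    · intro u hu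
      exact hu.1
    · intro u hu
      have h1 : (u, (0 : F)) ∈ (c z).toHomeo.target := hu.1
      have h2 : (((c z).chart z).symm u : N) ∈ (c w).toHomeo.source := hu.2
      rwa [(c z).coe_chart_symm h1] at h2
  have key2 := (contDiff_fst (𝕜 := ℝ) (E := ES k) (F := F) (n := ∞)).comp_contDiffOn
    key.contDiffOn
  refine (key2.congr ?_).mono ?_
  · intro u hu
    have h1 : (u, (0 : F)) ∈ (c z).toHomeo.target := hu.1
    simp [(c z).coe_chart_symm h1]
  · intro u hu
    simpa using hu.1

variable [I.Boundaryless] [IsManifold I ∞ N]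

/-- A diffeomorphism of an open set of `N` onto an open set of the model space, as a chart. -/
lemma exists_mem_maximalAtlas (e : OpenPartialHomeomorph N E)
    (h : ContMDiffOn I 𝓘(ℝ, E) ∞ e e.source) (h' : ContMDiffOn 𝓘(ℝ, E) I ∞ e.symm e.target) :
    e.trans I.toHomeomorph.symm.toOpenPartialHomeomorph ∈ IsManifold.maximalAtlas I ∞ N := by
  apply OpenPartialHomeomorph.mem_maximalAtlas_of_contMDiffOn
  · have : ContMDiff 𝓘(ℝ, E) I ∞ I.symm := by
      have := I.contMDiffOn_symm (n := ∞)
      rwa [I.range_eq_univ, contMDiffOn_univ] at this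
    exact (this.comp_contMDiffOn h).mono (by simp)
  · refine (h'.comp (I.contMDiff.contMDiffOn (s := I ⁻¹' e.target)) fun x hx => hx).mono ?_
    intro x hx
    simpa using hx

/-- Read in the induced chart of `S` and in the slice chart followed by `L z`, the inclusion is `u ↦
L z (u, 0)`, the normal form of an immersion. The maps `L` are there because charts of `N` must take
values in the model space `E` itself. -/
lemma isEmbeddedSubmanifold_of_slices (L : S → (ES k × F) ≃L[ℝ] E) :
    @IsEmbeddedSubmanifold E H N _ _ _ _ _ I k S (chartedSpaceOfSlices c hc) := by
  let := chartedSpaceOfSlices c hc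
  have := isManifold_chartedSpaceOfSlices c hc
  refine ⟨inferInstance, ?_, Topology.IsEmbedding.subtypeVal⟩
  suffices h : Manifold.IsImmersionOfComplement F (𝓡 k) I ∞ (Subtype.val : S → N) from
    h.isImmersion
  intro z
  let e : OpenPartialHomeomorph N E := (c z).toHomeo.trans
    (L z).toHomeomorph.toOpenPartialHomeomorph
  have he : ContMDiffOn I 𝓘(ℝ, E) ∞ e e.source :=
    ((L z).contDiff.contMDiff.comp_contMDiffOn (c z).contMDiffOn).mono (by simp [e])
  have he' : ContMDiffOn 𝓘(ℝ, E) I ∞ e.symm e.target := by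
    refine ((c z).contMDiffOn_symm.comp (L z).symm.contDiff.contMDiff.contMDiffOn
      (s := (L z).symm ⁻¹' (c z).toHomeo.target) fun x hx => hx).mono ?_
    intro x hx
    simpa [e] using hx
  refine Manifold.IsImmersionAtOfComplement.mk_of_charts (L z) ((c z).chart z)
    (e.trans I.toHomeomorph.symm.toOpenPartialHomeomorph) (hc z) (by simpa [e] using hc z)
    (IsManifold.chart_mem_maximalAtlas z) (exists_mem_maximalAtlas e he he') ?_ ?_
  · intro x hx
    simpa [e] using hx
  · intro u hu
    have h1 : (u, (0 : F)) ∈ (c z).toHomeo.target :=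
      (c z).mem_chart_target.1 (by simpa using hu)
    simp [e, (c z).coe_chart_symm h1, (c z).toHomeo.right_inv h1]
    rw [← I.toHomeomorph_apply, ← I.toHomeomorph_symm_apply, Homeomorph.apply_symm_apply]

end Slice

/-! ### The inverse function theorem and regular level sets -/

section LevelSet

variable {E H N : Type*} [NormedAddCommGroup E] [NormedSpace ℝ E] [TopologicalSpace H]
  [TopologicalSpace N] [ChartedSpace H N] {I : ModelWithCorners ℝ E H}
  [I.Boundaryless] [IsManifold I ∞ N]

-- The manifold derivative is by definition a derivative within the range of the model; without
-- boundary this range is everything, so ordinary calculus applies.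
omit [IsManifold I ∞ N] in
lemma hasFDerivAt_comp_extChartAt_symm {F : Type*} [NormedAddCommGroup F] [NormedSpace ℝ F]
    {f : N → F} {z : N} (h : MDifferentiableAt I 𝓘(ℝ, F) f z) :
    HasFDerivAt (E := E) (F := F) (f ∘ (extChartAt I z).symm) (mfderiv I 𝓘(ℝ, F) f z)
      (extChartAt I z z) :=
  hasFDerivWithinAt_univ.1 (I.range_eq_univ ▸ h.hasMFDerivAt.2)

/-- The inverse function theorem for smooth maps from a manifold to a vector space, with a local
inverse that is smooth on its whole domain. -/
lemma exists_openPartialHomeomorph_of_hasFDerivAt {G : Type*} [NormedAddCommGroup G]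
    [NormedSpace ℝ G] [CompleteSpace E] {Ψ : N → G} {U : Set N} (hU : IsOpen U) {z : N}
    (hz : z ∈ U) (hΨ : ContMDiffOn I 𝓘(ℝ, G) ∞ Ψ U) (L : E ≃L[ℝ] G)
    (hL : HasFDerivAt (Ψ ∘ (extChartAt I z).symm) (L : E →L[ℝ] G) (extChartAt I z z)) :
    ∃ e : OpenPartialHomeomorph N G, z ∈ e.source ∧ e.source ⊆ U ∧
      (∀ x ∈ e.source, e x = Ψ x) ∧ ContMDiffOn I 𝓘(ℝ, G) ∞ e e.source ∧
      ContMDiffOn 𝓘(ℝ, G) I ∞ e.symm e.target := by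
  set f := Ψ ∘ (extChartAt I z).symm with hf
  set a := extChartAt I z z with ha
  let V : Set E := (extChartAt I z).target ∩ (extChartAt I z).symm ⁻¹' U
  have hV : IsOpen V := (continuousOn_extChartAt_symm z).isOpen_inter_preimage
    (isOpen_extChartAt_target z) hU
  have haV : a ∈ V := ⟨mem_extChartAt_target z, by simpa [ha] using hz⟩
  have hfV : ContDiffOn ℝ ∞ f V := by
    rw [← contMDiffOn_iff_contDiffOn]
    exact hΨ.comp ((contMDiffOn_extChartAt_symm z).mono Set.inter_subset_left) fun x hx => hx.2
  have hfa : ∀ x ∈ V, ContDiffAt ℝ ∞ f x := fun x hx => hfV.contDiffAt (hV.mem_nhds hx)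
  -- Invertibility of the derivative is an open condition. Shrinking to `W` makes the local inverse
  -- smooth at every point of its domain and not only at the image of `a`.
  let W : Set E := V ∩ fderiv ℝ f ⁻¹' Set.range ((↑) : (E ≃L[ℝ] G) → E →L[ℝ] G)
  have hW : IsOpen W := (hfV.continuousOn_fderiv_of_isOpen hV (by simp)).isOpen_inter_preimage hV
    ContinuousLinearEquiv.isOpen
  have haW : a ∈ W := ⟨haV, L, hL.fderiv.symm⟩
  let e₀ := ((hfa a haV).toOpenPartialHomeomorph f hL (by simp)).restrOpen W hW
  have he₀ : ∀ x, e₀ x = f x := fun x => rfl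
  have he₀W : e₀.source ⊆ W := fun x hx => hx.2
  have ha₀ : a ∈ e₀.source :=
    ⟨(hfa a haV).mem_toOpenPartialHomeomorph_source hL (by simp), haW⟩
  have hsymm : ContDiffOn ℝ ∞ e₀.symm e₀.target := by
    intro y hy
    have hx := he₀W (e₀.map_target hy)
    obtain ⟨L', hL'⟩ := hx.2
    refine (e₀.contDiffAt_symm hy (f₀' := L') ?_ (hfa _ hx.1)).contDiffWithinAt
    rw [hL']
    exact ((hfa _ hx.1).differentiableAt (by simp)).hasFDerivAt
  let c : OpenPartialHomeomorph N E := (chartAt H z).trans I.toHomeomorph.toOpenPartialHomeomorph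
  have hcs : c.source = (extChartAt I z).source := by simp [c]
  have hcx : ∀ x, c x = extChartAt I z x := fun x => rfl
  have hcy : ∀ y, c.symm y = (extChartAt I z).symm y := fun x => rfl
  have hsrc : ∀ x ∈ (c.trans e₀).source, x ∈ U ∧ (c.trans e₀) x = Ψ x := by
    intro x hx
    have h1 : x ∈ (extChartAt I z).source := hcs ▸ hx.1
    have h2 := (he₀W hx.2).1.2
    have h3 : (extChartAt I z).symm (c x) = x := by rw [hcx]; exact (extChartAt I z).left_inv h1
    have h2 : (extChartAt I z).symm (c x) ∈ U := h2
    rw [h3] at h2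
    refine ⟨h2, ?_⟩
    change f (c x) = Ψ x
    rw [hf, Function.comp_apply, h3]
  refine ⟨c.trans e₀, ⟨?_, ha₀⟩, fun x hx => (hsrc x hx).1, fun x hx => (hsrc x hx).2, ?_, ?_⟩
  · change z ∈ c.source
    rw [hcs]
    exact mem_extChartAt_source z
  · exact (hΨ.mono fun x hx => (hsrc x hx).1).congr fun x hx => (hsrc x hx).2
  · refine ((contMDiffOn_extChartAt_symm z).comp (hsymm.contMDiffOn) fun y hy => ?_).mono
      (s := e₀.target) ?_
    · exact (he₀W (e₀.map_target hy)).1.1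
    · intro y hy
      exact hy.1

/-- A slice chart obtained from a smooth map `(ρ, f)` with invertible derivative. -/
lemma exists_sliceChart {F : Type*} [NormedAddCommGroup F] [NormedSpace ℝ F] [CompleteSpace E]
    {k : ℕ} {S U : Set N} (hU : IsOpen U) {z : N} (hz : z ∈ U) {ρ : N → ES k} {f : N → F}
    (hρ : ContMDiffOn I 𝓘(ℝ, ES k) ∞ ρ U) (hf : ContMDiffOn I 𝓘(ℝ, F) ∞ f U)
    (hS : ∀ x ∈ U, x ∈ S ↔ f x = 0) (L : E ≃L[ℝ] ES k × F)
    (hL : HasFDerivAt ((fun x => (ρ x, f x)) ∘ (extChartAt I z).symm) (L : E →L[ℝ] ES k × F)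
      (extChartAt I z z)) :
    ∃ c : SliceChart I k F S, z ∈ c.toHomeo.source ∧ c.toHomeo.source ⊆ U ∧
      ∀ x ∈ c.toHomeo.source, c.toHomeo x = (ρ x, f x) := by
  obtain ⟨e, h1, h2, h3, h4, h5⟩ := exists_openPartialHomeomorph_of_hasFDerivAt hU hz
    (hρ.prodMk_space hf) L hL
  exact ⟨⟨e, h4, h5, fun x hx => by rw [h3 x hx]; exact hS x (h2 hx)⟩, h1, h2, h3⟩

/-- Take for `P` a projection onto `ker D`, followed by an identification of the kernel with `ℝᵏ`: a
vector killed by `D` lies in the kernel, where `P` is injective. The subtraction in `hk` is not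
truncated, since surjectivity of `D` bounds the dimension of `F` by that of `E`. -/
lemma exists_clm_equiv_prod [FiniteDimensional ℝ E] {F : Type*} [NormedAddCommGroup F]
    [NormedSpace ℝ F] [FiniteDimensional ℝ F] (D : E →L[ℝ] F) (hD : Function.Surjective D)
    {k : ℕ} (hk : k = Module.finrank ℝ E - Module.finrank ℝ F) :
    ∃ (P : E →L[ℝ] ES k) (L : E ≃L[ℝ] ES k × F), (L : E →L[ℝ] ES k × F) = P.prod D := by
  have hrk := D.toLinearMap.finrank_range_add_finrank_ker
  have hD' : LinearMap.range D.toLinearMap = ⊤ := LinearMap.range_eq_top.2 hD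
  rw [hD', finrank_top] at hrk
  have : Module.finrank ℝ (LinearMap.ker D.toLinearMap) = Module.finrank ℝ (ES k) := by
    rw [finrank_euclideanSpace_fin]; omega
  let j := LinearEquiv.ofFinrankEq _ _ this
  obtain ⟨p, hp⟩ := LinearMap.exists_leftInverse_of_injective
    (LinearMap.ker D.toLinearMap).subtype (Submodule.ker_subtype _)
  let P : E →L[ℝ] ES k := LinearMap.toContinuousLinearMap (j.toLinearMap ∘ₗ p)
  have hinj : Function.Injective (P.prod D).toLinearMap := by
    rw [← LinearMap.ker_eq_bot, LinearMap.ker_eq_bot']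
    intro x hx
    have h1 : j (p x) = 0 := congrArg Prod.fst hx
    have h2 : D x = 0 := congrArg Prod.snd hx
    have h3 : p x = ⟨x, h2⟩ := LinearMap.congr_fun hp ⟨x, h2⟩
    rw [h3, LinearEquiv.map_eq_zero_iff] at h1
    exact congrArg Subtype.val h1
  have hfin : Module.finrank ℝ E = Module.finrank ℝ (ES k × F) := by
    rw [Module.finrank_prod, finrank_euclideanSpace_fin]; omega
  exact ⟨P, (LinearEquiv.ofInjectiveOfFinrankEq _ hinj hfin).toContinuousLinearEquiv, by
    ext x <;> rfl⟩

lemma range_eq_ker_of_finrank {E F : Type*} [NormedAddCommGroup E] [NormedSpace ℝ E]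
    [FiniteDimensional ℝ E] [NormedAddCommGroup F] [NormedSpace ℝ F] {k : ℕ} {T : ES k →L[ℝ] E}
    {D : E →L[ℝ] F} (hT : Function.Injective T) (hD : Function.Surjective D)
    (hk : k = Module.finrank ℝ E - Module.finrank ℝ F) (hDT : ∀ v, D (T v) = 0) :
    LinearMap.range T.toLinearMap = LinearMap.ker D.toLinearMap := by
  have hker := D.toLinearMap.finrank_range_add_finrank_ker
  rw [LinearMap.range_eq_top.2 hD, finrank_top] at hker
  have hrange := LinearMap.finrank_range_of_inj (f := T.toLinearMap) hT
  rw [finrank_euclideanSpace_fin] at hrange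
  refine Submodule.eq_of_le_of_finrank_eq ?_ (by omega)
  rintro _ ⟨v, rfl⟩
  exact hDT v

/-- **Regular level set theorem.** -/
theorem exists_isEmbeddedSubmanifold_of_surjective_mfderiv [FiniteDimensional ℝ E] {F : Type*}
    [NormedAddCommGroup F] [NormedSpace ℝ F] [FiniteDimensional ℝ F] {f : N → F}
    (hf : ContMDiff I 𝓘(ℝ, F) ∞ f) (b : F) {S : Set N} (hS : ∀ x, x ∈ S ↔ f x = b)
    (hsurj : ∀ x ∈ S, Function.Surjective (mfderiv I 𝓘(ℝ, F) f x))
    {k : ℕ} (hk : k = Module.finrank ℝ E - Module.finrank ℝ F) :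
    ∃ _ : ChartedSpace (ES k) S, IsEmbeddedSubmanifold I k S ∧
      ∀ z : S, submanifoldTangent I k S z =
        LinearMap.ker (mfderiv I 𝓘(ℝ, F) f z).toLinearMap := by
  have hslice : ∀ z : S, ∃ (c : SliceChart I k F S) (_ : E ≃L[ℝ] ES k × F),
      (z : N) ∈ c.toHomeo.source := by
    intro z
    have hmf : MDifferentiableAt I 𝓘(ℝ, F) f z := (hf z).mdifferentiableAt (by simp)
    -- The linear map `P` complements the differential of `f`, so `(P ∘ chart, f - b)` has
    -- invertible differential and gives a slice chart.
    obtain ⟨P, L, hPL⟩ := exists_clm_equiv_prod (E := E) (F := F) (mfderiv I 𝓘(ℝ, F) f z) (hsurj z z.2) hk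
    obtain ⟨c, hc, -⟩ := exists_sliceChart (I := I) (S := S) (isOpen_extChartAt_source (I := I) z.1)
      (mem_extChartAt_source z.1) (ρ := fun x => P (extChartAt I z.1 x)) (f := fun x => f x - b)
      (P.contDiff.contMDiff.comp_contMDiffOn (extChartAt_source I z.1 ▸ contMDiffOn_extChartAt))
      (hf.sub contMDiff_const).contMDiffOn (fun x _ => by rw [hS, sub_eq_zero]) L (by
        rw [hPL]
        refine HasFDerivAt.prodMk ?_ ?_
        · refine P.hasFDerivAt.congr_of_eventuallyEq ?_
          filter_upwards [extChartAt_target_mem_nhds (I := I) z.1] with u hu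
          rw [(extChartAt I z.1).right_inv hu]
        · exact (hasFDerivAt_comp_extChartAt_symm hmf).sub_const b)
    exact ⟨c, L, hc⟩
  choose c L hc using hslice
  have hemb := isEmbeddedSubmanifold_of_slices c hc fun z => (L z).symm
  refine ⟨chartedSpaceOfSlices c hc, hemb, ?_⟩
  let := chartedSpaceOfSlices c hc
  have := hemb.isManifold
  intro z
  have hval : MDifferentiableAt (𝓡 k) I (Subtype.val : S → N) z :=
    (hemb.isSmoothEmbedding.contMDiff z).mdifferentiableAt (by simp)
  have hmf : MDifferentiableAt I 𝓘(ℝ, F) f z := (hf z).mdifferentiableAt (by simp)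
  have hcomp : ∀ v : ES k, mfderiv I 𝓘(ℝ, F) f z (mfderiv (𝓡 k) I (Subtype.val : S → N) z v) = 0 := by
    intro v
    have h1 := mfderiv_comp z hmf hval
    have h2 : f ∘ (Subtype.val : S → N) = fun _ => b := funext fun x => (hS x).1 x.2
    rw [h2, mfderiv_const] at h1
    exact (congrArg (fun T : ES k →L[ℝ] F => T v) h1).symm
  -- The first component of the slice chart, composed with the inclusion, is the chart of `S` at
  -- `z`, whose differential is invertible. The differential of the inclusion is therefore
  -- injective.
  have hinj : Function.Injective (mfderiv (𝓡 k) I (Subtype.val : S → N) z) := by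
    have hΦ : MDifferentiableAt I 𝓘(ℝ, ES k × F) (c z).toHomeo z :=
      ((c z).contMDiffOn.contMDiffAt ((c z).toHomeo.open_source.mem_nhds (hc z))).mdifferentiableAt
        (by simp)
    have hΦ' : MDifferentiableAt I 𝓘(ℝ, ES k) (fun x => ((c z).toHomeo x).1) z :=
      (contDiff_fst.contMDiff.mdifferentiableAt (n := 1) (by simp)).comp (z : N) hΦ
    have h1 := mfderiv_comp z hΦ' hval
    have h2 : (fun x => ((c z).toHomeo x).1) ∘ (Subtype.val : S → N) = extChartAt (𝓡 k) z := rfl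
    rw [h2] at h1
    have h3 := (isInvertible_mfderiv_extChartAt (I := 𝓡 k)
      (mem_extChartAt_source (I := 𝓡 k) z)).injective
    rw [h1] at h3
    exact Function.Injective.of_comp h3
  exact range_eq_ker_of_finrank (E := E) (F := F) hinj (hsurj z z.2) hk hcomp

end LevelSet

/-! ### Adapted charts of the regularized space -/

section Charts

variable {n : ℕ} {M : Type*} [TopologicalSpace M] [ChartedSpace (ES n) M] {φ : M → ℝ}

/-- Charts of `Ω̂` of the form `(x, ξ) ↦ ψ(x) + ξ v`, where `ψ` is the preferred chart of `M` at the
centre, and the vector `v` vanishes off `Γ̂` and satisfies `dφ(v) = 1` on `Γ̂`. -/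
structure AdaptedCharts (φ : M → ℝ) [ChartedSpace (ES n) (regularized φ)]
    (v : regularized φ → ES n) : Prop where
  embedded : IsEmbeddedSubmanifold ((𝓡 n).prod 𝓘(ℝ, ℝ)) n (regularized φ)
  v_eq_zero : ∀ y : regularized φ, y.1.2 ≠ 0 → v y = 0
  mfderiv_v : ∀ y : regularized φ, y.1.2 = 0 → mfderiv (𝓡 n) 𝓘(ℝ, ℝ) φ y.1.1 (v y) = (1 : ℝ)
  mem_source : ∀ y w : regularized φ, w ∈ (extChartAt (𝓡 n) y).source →
    w.1.1 ∈ (extChartAt (𝓡 n) y.1.1).source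
  chart_eq : ∀ y w : regularized φ, w ∈ (extChartAt (𝓡 n) y).source →
    extChartAt (𝓡 n) y w = extChartAt (𝓡 n) y.1.1 w.1.1 + w.1.2 • v y

omit [TopologicalSpace M] in
lemma mem_boundary_iff {y : regularized φ} : y.1.1 ∈ boundary φ ↔ y.1.2 = 0 := by
  have h : y.1.2 ^ 2 = 2 * φ y.1.1 := y.2
  change φ y.1.1 = 0 ↔ _
  constructor
  · intro h0
    rw [h0, mul_zero] at h
    exact pow_eq_zero_iff (two_ne_zero) |>.1 h
  · intro h0
    rw [h0] at h
    linarith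

omit [TopologicalSpace M] in
lemma mem_domain_iff {y : regularized φ} : y.1.1 ∈ domain φ ↔ y.1.2 ≠ 0 := by
  have h : y.1.2 ^ 2 = 2 * φ y.1.1 := y.2
  change 0 < φ y.1.1 ↔ _
  rw [← sq_pos_iff, h]
  constructor <;> intro h <;> linarith

lemma exists_transversal (hdφ : ∀ x ∈ boundary φ, mfderiv (𝓡 n) 𝓘(ℝ, ℝ) φ x ≠ 0)
    (y : regularized φ) : ∃ v : ES n, (y.1.2 ≠ 0 → v = 0) ∧
      (y.1.2 = 0 → mfderiv (𝓡 n) 𝓘(ℝ, ℝ) φ y.1.1 v = (1 : ℝ)) := by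
  by_cases hy : y.1.2 = 0
  · have h := hdφ _ (mem_boundary_iff.2 hy)
    obtain ⟨w, hw⟩ : ∃ w : ES n, (mfderiv (𝓡 n) 𝓘(ℝ, ℝ) φ y.1.1 : ES n →L[ℝ] ℝ) w ≠ 0 := by
      by_contra! h0
      exact h (ContinuousLinearMap.ext h0)
    set D : ES n →L[ℝ] ℝ := mfderiv (𝓡 n) 𝓘(ℝ, ℝ) φ y.1.1 with hD
    refine ⟨(D w)⁻¹ • w, fun h0 => absurd hy h0, fun _ => ?_⟩
    change D ((D w)⁻¹ • w) = 1
    rw [map_smul, smul_eq_mul, inv_mul_cancel₀ hw]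
  · exact ⟨0, fun _ => rfl, fun h0 => absurd h0 hy⟩

/-- This is the differential `(a, b) ↦ (a + b v, 2ξ b - 2 D a)` of `(x, ξ) ↦ (ψ(x) + ξ v, ξ² -
2φ(x))`. On its kernel `a = -b v`. If `ξ = 0`, then `D a = -b` must vanish; if `ξ ≠ 0`, then `v =
0`, so `a = 0` and `ξ b = 0`. -/
lemma exists_equiv_adapted {D : ES n →L[ℝ] ℝ} {v : ES n} {ξ : ℝ} (h0 : ξ ≠ 0 → v = 0)
    (h1 : ξ = 0 → D v = 1) :
    ∃ L : (ES n × ℝ) ≃L[ℝ] ES n × ℝ, (L : (ES n × ℝ) →L[ℝ] ES n × ℝ) =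
      (ContinuousLinearMap.fst ℝ (ES n) ℝ + (ContinuousLinearMap.snd ℝ (ES n) ℝ).smulRight v).prod
        ((2 * ξ) • ContinuousLinearMap.snd ℝ (ES n) ℝ -
          (2 : ℝ) • D.comp (ContinuousLinearMap.fst ℝ (ES n) ℝ)) := by
  set T := (ContinuousLinearMap.fst ℝ (ES n) ℝ +
    (ContinuousLinearMap.snd ℝ (ES n) ℝ).smulRight v).prod
        ((2 * ξ) • ContinuousLinearMap.snd ℝ (ES n) ℝ -
          (2 : ℝ) • D.comp (ContinuousLinearMap.fst ℝ (ES n) ℝ)) with hT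
  have hinj : Function.Injective T.toLinearMap := by
    rw [← LinearMap.ker_eq_bot, LinearMap.ker_eq_bot']
    rintro ⟨a, b⟩ hab
    have e1 : a + b • v = 0 := congrArg Prod.fst hab
    have e2 : 2 * ξ * b - 2 * D a = 0 := congrArg Prod.snd hab
    by_cases hξ : ξ = 0
    · have ha : a = -(b • v) := eq_neg_of_add_eq_zero_left e1
      rw [ha, map_neg, map_smul, h1 hξ, hξ] at e2
      have hb : b = 0 := by simpa using e2
      simp [ha, hb]
    · have ha : a = 0 := by simpa [h0 hξ] using e1
      rw [ha, map_zero] at e2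
      have hb : b = 0 := by simpa [hξ] using e2
      simp [ha, hb]
  exact ⟨(LinearEquiv.ofInjectiveEndo _ hinj).toContinuousLinearEquiv, by ext <;> rfl⟩

variable [IsManifold (𝓡 n) ∞ M]

/-- The inverse function theorem applies to `(x, ξ) ↦ (ψ(x) + ξ v, ξ² - 2φ(x))`, and the vanishing
of the second component defines `Ω̂`. -/
theorem exists_adaptedCharts (hφ : ContMDiff (𝓡 n) 𝓘(ℝ, ℝ) ∞ φ)
    (hdφ : ∀ x ∈ boundary φ, mfderiv (𝓡 n) 𝓘(ℝ, ℝ) φ x ≠ 0) :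
    ∃ (_ : ChartedSpace (ES n) (regularized φ)) (v : regularized φ → ES n),
      AdaptedCharts φ v := by
  choose v hv0 hv1 using exists_transversal (n := n) hdφ
  have hslice : ∀ y : regularized φ, ∃ (c : SliceChart ((𝓡 n).prod 𝓘(ℝ, ℝ)) n ℝ (regularized φ))
      (_ : (ES n × ℝ) ≃L[ℝ] ES n × ℝ), (y : M × ℝ) ∈ c.toHomeo.source ∧
      ∀ w ∈ c.toHomeo.source, w.1 ∈ (extChartAt (𝓡 n) y.1.1).source ∧
        (c.toHomeo w).1 = extChartAt (𝓡 n) y.1.1 w.1 + w.2 • v y := by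
    intro y
    obtain ⟨L, hL⟩ := exists_equiv_adapted (hv0 y) (hv1 y)
    have hU : IsOpen ((Prod.fst : M × ℝ → M) ⁻¹' (extChartAt (𝓡 n) y.1.1).source) :=
      (isOpen_extChartAt_source y.1.1).preimage continuous_fst
    obtain ⟨c, h1, h2, h3⟩ := exists_sliceChart (I := (𝓡 n).prod 𝓘(ℝ, ℝ)) (S := regularized φ)
      (z := y.1) hU (mem_extChartAt_source (I := 𝓡 n) y.1.1)
      (ρ := fun w => extChartAt (𝓡 n) y.1.1 w.1 + w.2 • v y) (f := fun w => w.2 ^ 2 - 2 * φ w.1)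
      (by
        refine ContMDiffOn.add ?_ ?_
        · refine (contMDiffOn_extChartAt (I := 𝓡 n) (n := ∞) (x := y.1.1)).comp
            contMDiff_fst.contMDiffOn ?_
          rw [extChartAt_source]
        · exact (contMDiff_snd.smul contMDiff_const).contMDiffOn)
      ((contMDiff_snd.pow 2).sub (contMDiff_const.mul (hφ.comp contMDiff_fst))).contMDiffOn
      (fun w _ => sub_eq_zero.symm) L (by
        rw [hL]
        have hφy : MDifferentiableAt (𝓡 n) 𝓘(ℝ, ℝ) φ y.1.1 := (hφ _).mdifferentiableAt (by simp)
        have hd := hasFDerivAt_comp_extChartAt_symm hφy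
        refine HasFDerivAt.prodMk ?_ ?_
        · have h4 : HasFDerivAt (fun p : ES n × ℝ => p.1 + p.2 • v y) _
            (extChartAt (𝓡 n) y.1.1 y.1.1, y.1.2) := (ContinuousLinearMap.fst ℝ (ES n) ℝ +
              (ContinuousLinearMap.snd ℝ (ES n) ℝ).smulRight (v y)).hasFDerivAt
          refine h4.congr_of_eventuallyEq ?_
          have h5 : ∀ᶠ p : ES n × ℝ in 𝓝 (extChartAt (𝓡 n) y.1.1 y.1.1, y.1.2),
              p.1 ∈ (extChartAt (𝓡 n) y.1.1).target :=
            continuous_fst.continuousAt.eventually (extChartAt_target_mem_nhds (I := 𝓡 n) y.1.1)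
          filter_upwards [h5] with p hp
          exact congrArg (· + p.2 • v y) ((extChartAt (𝓡 n) y.1.1).right_inv hp)
        · have h4 : HasFDerivAt (fun p : ES n × ℝ => p.2 ^ 2 -
              2 * (φ ∘ (extChartAt (𝓡 n) y.1.1).symm) p.1) _
              (extChartAt (𝓡 n) y.1.1 y.1.1, y.1.2) :=
            ((hasFDerivAt_snd (𝕜 := ℝ) (p := (extChartAt (𝓡 n) y.1.1 y.1.1, y.1.2))).pow 2).sub
              ((HasFDerivAt.comp (g := φ ∘ (extChartAt (𝓡 n) y.1.1).symm)
                (extChartAt (𝓡 n) y.1.1 y.1.1, y.1.2) hd hasFDerivAt_fst).const_mul 2)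
          refine HasFDerivAt.congr_fderiv (by exact h4) ?_
          simp)
    refine ⟨c, L, h1, fun w hw => ⟨h2 hw, by rw [h3 w hw]⟩⟩
  choose c L hc hcw using hslice
  refine ⟨chartedSpaceOfSlices c hc, v, ?_⟩
  let := chartedSpaceOfSlices c hc
  have hs : ∀ y w : regularized φ, w ∈ (extChartAt (𝓡 n) y).source →
      (w : M × ℝ) ∈ (c y).toHomeo.source := by
    intro y w hw
    rw [extChartAt_source] at hw
    exact hw
  exact ⟨isEmbeddedSubmanifold_of_slices c hc fun z => (L z), hv0, hv1,
    fun y w hw => (hcw y w (hs y w hw)).1, fun y w hw => (hcw y w (hs y w hw)).2⟩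

end Charts

/-! ### The double and the covering over `Ω` -/

section Topological

variable {M : Type*} [TopologicalSpace M] {φ : M → ℝ}

omit [TopologicalSpace M] in
lemma regularized_snd_eq (y : regularized φ) :
    y.1.2 = √(2 * φ y.1.1) ∨ y.1.2 = -√(2 * φ y.1.1) := by
  have h : y.1.2 ^ 2 = 2 * φ y.1.1 := y.2
  rw [← sq_eq_sq_iff_eq_or_eq_neg, Real.sq_sqrt (h ▸ sq_nonneg _), h]

/-- The sign `±1` that distinguishes the two sheets of `Ω̂`. -/
def sheetSign (b : Bool) : ℝ := if b then -1 else 1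

lemma sheetSign_sq (b : Bool) : sheetSign b ^ 2 = 1 := by cases b <;> simp [sheetSign]

/-- The point of the sheet `b` of `Ω̂` over `x`. -/
def sheet {x : M} (hx : 0 ≤ φ x) (b : Bool) : regularized φ :=
  ⟨(x, sheetSign b * √(2 * φ x)), by
    change (sheetSign b * √(2 * φ x)) ^ 2 = 2 * φ x
    rw [mul_pow, sheetSign_sq, Real.sq_sqrt (by linarith), one_mul]⟩

omit [TopologicalSpace M] in
lemma exists_sheet_eq (y : regularized φ) : ∃ (hx : 0 ≤ φ y.1.1) (b : Bool), sheet hx b = y := by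
  have h : y.1.2 ^ 2 = 2 * φ y.1.1 := y.2
  have hx : 0 ≤ φ y.1.1 := by nlinarith [sq_nonneg y.1.2]
  rcases regularized_snd_eq y with h1 | h1
  · exact ⟨hx, false, Subtype.ext (Prod.ext rfl (by simp [sheet, sheetSign, h1]))⟩
  · exact ⟨hx, true, Subtype.ext (Prod.ext rfl (by simp [sheet, sheetSign, h1]))⟩

omit [TopologicalSpace M] in
lemma sheet_eq_iff {x x' : M} {hx : 0 ≤ φ x} {hx' : 0 ≤ φ x'} {b b' : Bool} :
    sheet hx b = sheet hx' b' ↔ x = x' ∧ (b = b' ∨ x ∈ boundary φ) := by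
  constructor
  · intro h
    have h1 : x = x' := congrArg (fun y : regularized φ => y.1.1) h
    have h2 : sheetSign b * √(2 * φ x) = sheetSign b' * √(2 * φ x') :=
      congrArg (fun y : regularized φ => y.1.2) h
    subst h1
    refine ⟨rfl, ?_⟩
    by_cases h0 : φ x = 0
    · exact Or.inr h0
    · have hpos : 0 < √(2 * φ x) := Real.sqrt_pos.2 (by positivity)
      have h3 := mul_right_cancel₀ hpos.ne' h2
      left
      cases b <;> cases b' <;> simp [sheetSign] at h3 ⊢ <;> linarith
  · rintro ⟨rfl, rfl | h⟩
    · rfl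
    · have h0 : φ x = 0 := h
      exact Subtype.ext (Prod.ext rfl (by simp [sheet, h0]))

/-- The projection inverts the sheet continuously, so the sheet is an embedding; its image is closed
because it is given by the equation `ξ = ±√(2φ)` over the closed set `A`. -/
lemma isClosedEmbedding_sheet (hφ : Continuous φ) {A : Set M} (hA : IsClosed A)
    (hA0 : ∀ x ∈ A, 0 ≤ φ x) (b : Bool) :
    Topology.IsClosedEmbedding (fun x : A => sheet (φ := φ) (hA0 x x.2) b) := by
  have hc : Continuous (fun x : A => sheet (φ := φ) (hA0 x x.2) b) := by
    refine Continuous.subtype_mk ?_ _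
    fun_prop
  have hemb : Topology.IsEmbedding (fun x : A => sheet (φ := φ) (hA0 x x.2) b) :=
    Topology.IsEmbedding.of_comp hc
      (continuous_fst.comp continuous_subtype_val) Topology.IsEmbedding.subtypeVal
  refine ⟨hemb, ?_⟩
  have : Set.range (fun x : A => sheet (φ := φ) (hA0 x x.2) b) =
      {y : regularized φ | y.1.1 ∈ A ∧ y.1.2 = sheetSign b * √(2 * φ y.1.1)} := by
    ext y
    constructor
    · rintro ⟨x, rfl⟩
      exact ⟨x.2, rfl⟩
    · rintro ⟨h1, h2⟩
      exact ⟨⟨y.1.1, h1⟩, Subtype.ext (Prod.ext rfl h2.symm)⟩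
  rw [this]
  exact (hA.preimage (continuous_fst.comp continuous_subtype_val)).inter
    (isClosed_eq (by fun_prop) (by fun_prop))

/-- `Ω̂` is the double of `{φ ≥ 0}` along `{φ = 0}`. -/
theorem exists_homeomorph_double (hφ : Continuous φ) {A : Set M} (hA : A = {x | 0 ≤ φ x}) :
    ∃ e : Double A (boundary φ) ≃ₜ regularized φ,
      ∀ (x : A) (b : Bool), proj φ (e (Quotient.mk _ (x, b))) = x := by
  have hA0 : ∀ x ∈ A, 0 ≤ φ x := fun x hx => by rw [hA] at hx; exact hx
  have hcl : IsClosed A := hA ▸ isClosed_le continuous_const hφ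
  let f₀ : A × Bool → regularized φ := fun p => sheet (hA0 p.1 p.1.2) p.2
  have hf₀ : Continuous f₀ := continuous_prod_of_discrete_right.2
    fun b => (isClosedEmbedding_sheet hφ hcl hA0 b).continuous
  -- The image of a closed set is the union of two closed images, one in each sheet. Closedness
  -- passes to the quotient and replaces a separate proof that the inverse of the bijection is
  -- continuous.
  have hf₀' : IsClosedMap f₀ := by
    intro K hK
    have : f₀ '' K = ⋃ b : Bool, (fun x : A => sheet (φ := φ) (hA0 x x.2) b) ''
        ((fun x => (x, b)) ⁻¹' K) := by
      ext y
      simp only [Set.mem_image, Prod.exists, Set.mem_iUnion, Set.mem_preimage]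
      exact ⟨fun ⟨x, b, h, h'⟩ => ⟨b, x, h, h'⟩, fun ⟨b, x, h, h'⟩ => ⟨x, b, h, h'⟩⟩
    rw [this]
    exact isClosed_iUnion_of_finite fun b =>
      (isClosedEmbedding_sheet hφ hcl hA0 b).isClosedMap _ (hK.preimage (by fun_prop))
  have hrel : ∀ p q : A × Bool, (doubleSetoid A (boundary φ)) p q ↔ f₀ p = f₀ q := by
    rintro ⟨x, b⟩ ⟨x', b'⟩
    rw [sheet_eq_iff]
    constructor
    · rintro (h | ⟨h1, h2⟩)
      · simp only [Prod.mk.injEq] at h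
        exact ⟨congrArg _ h.1, Or.inl h.2⟩
      · exact ⟨congrArg _ h1, Or.inr h2⟩
    · rintro ⟨h1, h2⟩
      have h1' : x = x' := Subtype.ext h1
      rcases h2 with h2 | h2
      · exact Or.inl (Prod.ext h1' h2)
      · exact Or.inr ⟨h1', h2⟩
  let f : Double A (boundary φ) → regularized φ :=
    Quotient.lift f₀ fun p q h => (hrel p q).1 h
  have hf : Continuous f := hf₀.quotient_lift _
  have hbij : Function.Bijective f := by
    constructor
    · rintro ⟨p⟩ ⟨q⟩ h
      exact Quotient.sound ((hrel p q).2 h)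
    · intro y
      obtain ⟨hx, b, h⟩ := exists_sheet_eq y
      exact ⟨Quotient.mk _ (⟨y.1.1, hA ▸ hx⟩, b), h⟩
  have hclosed : IsClosedMap f := by
    intro K hK
    have : f '' K = f₀ '' (Quotient.mk _ ⁻¹' K) := by
      ext y
      constructor
      · rintro ⟨⟨p⟩, hp, rfl⟩
        exact ⟨p, hp, rfl⟩
      · rintro ⟨p, hp, rfl⟩
        exact ⟨_, hp, rfl⟩
    rw [this]
    exact hf₀' _ (hK.preimage continuous_quotient_mk')
  exact ⟨(Equiv.ofBijective f hbij).toHomeomorphOfContinuousClosed hf hclosed, fun x b => rfl⟩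

omit [TopologicalSpace M] in
lemma range_proj : Set.range (proj φ) = {x | 0 ≤ φ x} := by
  ext x
  constructor
  · rintro ⟨y, rfl⟩
    exact (exists_sheet_eq y).1
  · intro hx
    exact ⟨sheet hx false, rfl⟩

/-- All of `Ω` is evenly covered: over it `ξ` does not vanish, and its sign, encoded in `Bool`,
splits the preimage into two sheets. -/
lemma isCoveringMapOn_proj (hφ : Continuous φ) : IsCoveringMapOn (proj φ) (domain φ) := by
  intro x hx
  apply IsEvenlyCovered.to_isEvenlyCovered_preimage (I := Bool)
  have hproj : Continuous (proj φ) := continuous_fst.comp continuous_subtype_val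
  have hdom : IsOpen (domain φ) := isOpen_lt continuous_const hφ
  have hξ : ∀ y : proj φ ⁻¹' domain φ, y.1.1.2 ≠ 0 := fun y => mem_domain_iff.1 y.2
  refine ⟨inferInstance, domain φ, hx, hdom, hdom.preimage hproj, ?_⟩
  let e : proj φ ⁻¹' domain φ ≃ domain φ × Bool :=
    { toFun := fun y => (⟨proj φ y, y.2⟩, decide (y.1.1.2 < 0))
      invFun := fun p => ⟨sheet (le_of_lt p.1.2) p.2, p.1.2⟩
      left_inv := by
        intro y
        refine Subtype.ext (Subtype.ext (Prod.ext rfl ?_))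
        have hs := Real.sqrt_nonneg (2 * φ y.1.1.1)
        change sheetSign (decide (y.1.1.2 < 0)) * √(2 * φ y.1.1.1) = y.1.1.2
        rcases lt_or_gt_of_ne (hξ y) with h | h
        · rcases regularized_snd_eq y.1 with h1 | h1
          · linarith
          · rw [decide_eq_true h, sheetSign, if_pos rfl]
            linarith
        · rcases regularized_snd_eq y.1 with h1 | h1
          · rw [decide_eq_false h.le.not_gt, sheetSign, if_neg (by simp)]
            linarith
          · linarith
      right_inv := by
        rintro ⟨x, b⟩
        have hx0 : 0 < φ x := x.2
        refine Prod.ext rfl ?_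
        change decide (sheetSign b * √(2 * φ x) < 0) = b
        cases b <;> simp [sheetSign, hx0] }
  -- Since `ξ ≠ 0` here, both `ξ < 0` and its negation `ξ > 0` are open conditions, so the sign is
  -- locally constant.
  have hdec : Continuous fun y : proj φ ⁻¹' domain φ => decide (y.1.1.2 < 0) := by
    rw [continuous_discrete_rng]
    have hc : Continuous fun y : proj φ ⁻¹' domain φ => y.1.1.2 := by fun_prop
    rintro (_ | _)
    · have h : (fun y : proj φ ⁻¹' domain φ => decide (y.1.1.2 < 0)) ⁻¹' {false} =
          {y | 0 < y.1.1.2} := by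
        ext y
        change decide (y.1.1.2 < 0) = false ↔ 0 < y.1.1.2
        rw [decide_eq_false_iff_not, not_lt]
        exact ⟨fun h => lt_of_le_of_ne h (hξ y).symm, le_of_lt⟩
      rw [h]
      exact isOpen_lt continuous_const hc
    · have h : (fun y : proj φ ⁻¹' domain φ => decide (y.1.1.2 < 0)) ⁻¹' {true} =
          {y | y.1.1.2 < 0} := by
        ext y
        exact decide_eq_true_iff
      rw [h]
      exact isOpen_lt hc continuous_const
  refine ⟨⟨e, ?_, ?_⟩, fun _ => rfl⟩
  · exact ((hproj.comp continuous_subtype_val).subtype_mk _).prodMk hdec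
  · refine Continuous.subtype_mk (Continuous.subtype_mk ?_ _) _
    refine (by fun_prop : Continuous fun p : domain φ × Bool => (p.1 : M)).prodMk ?_
    have : Continuous sheetSign := continuous_of_discreteTopology
    fun_prop

omit [TopologicalSpace M] in
lemma ncard_fiber {x : M} (hx : x ∈ domain φ) : (proj φ ⁻¹' {x}).ncard = 2 := by
  have hx0 : 0 ≤ φ x := le_of_lt hx
  rw [Set.ncard_eq_two]
  refine ⟨sheet hx0 false, sheet hx0 true, ?_, ?_⟩
  · rw [Ne, sheet_eq_iff]
    rintro ⟨-, h | h⟩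
    · exact Bool.noConfusion h
    · exact (ne_of_gt hx) h
  · ext y
    simp only [Set.mem_preimage, Set.mem_singleton_iff, Set.mem_insert_iff]
    constructor
    · rintro rfl
      obtain ⟨h, b, hb⟩ := exists_sheet_eq y
      cases b
      · exact Or.inl hb.symm
      · exact Or.inr hb.symm
    · rintro (rfl | rfl) <;> rfl

end Topological

/-! ### The closure of `Ω` -/

section Closure

variable {n : ℕ} {M : Type*} [TopologicalSpace M] [ChartedSpace (ES n) M]
  {φ : M → ℝ}

/-- A zero of `φ` outside the closure of `{φ > 0}` would be a local maximum of `φ`, forcing `dφ = 0`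
there. -/
lemma closure_domain (hφ : ContMDiff (𝓡 n) 𝓘(ℝ, ℝ) ∞ φ)
    (hdφ : ∀ x ∈ boundary φ, mfderiv (𝓡 n) 𝓘(ℝ, ℝ) φ x ≠ 0) :
    closure (domain φ) = {x | 0 ≤ φ x} := by
  refine subset_antisymm (closure_minimal (fun x (hx : 0 < φ x) => hx.le)
    (isClosed_le continuous_const hφ.continuous)) fun x hx => ?_
  rcases lt_or_eq_of_le (show 0 ≤ φ x from hx) with h | h
  · exact subset_closure h
  · by_contra hcl
    refine hdφ x h.symm ?_
    have hmax : IsLocalMax φ x := by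
      have : (closure (domain φ))ᶜ ∈ 𝓝 x := isClosed_closure.isOpen_compl.mem_nhds hcl
      filter_upwards [this] with y hy
      rw [← h]
      exact not_lt.1 fun hy' => hy (subset_closure hy')
    have hmax' : IsLocalMax (φ ∘ (extChartAt (𝓡 n) x).symm) (extChartAt (𝓡 n) x x) := by
      have h1 := continuousAt_extChartAt_symm (I := 𝓡 n) x
      rw [ContinuousAt, extChartAt_to_inv] at h1
      filter_upwards [h1.eventually hmax] with u hu
      simpa using hu
    have hd := hasFDerivAt_comp_extChartAt_symm (I := 𝓡 n) ((hφ x).mdifferentiableAt (by simp))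
    exact hmax'.hasFDerivAt_eq_zero hd

end Closure

/-! ### Differentials of `π` and `ξ`, and the diffeomorphism of the boundaries -/

section ConfigurationSpace

variable {n : ℕ} {M : Type*} [TopologicalSpace M] [ChartedSpace (ES n) M] [IsManifold (𝓡 n) ∞ M]
  {φ : M → ℝ} [ChartedSpace (ES n) (regularized φ)] {v : regularized φ → ES n}

/-- The differential at `x` of the preferred chart at `x₀`; the tangent space at `x` is read in the
preferred chart at `x`. -/
def dchart {N : Type*} [TopologicalSpace N] [ChartedSpace (ES n) N] (x₀ x : N) :
    ES n →L[ℝ] ES n :=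
  mfderiv (𝓡 n) 𝓘(ℝ, ES n) (extChartAt (𝓡 n) x₀) x

lemma dchart_self {N : Type*} [TopologicalSpace N] [ChartedSpace (ES n) N]
    [IsManifold (𝓡 n) ∞ N] (x : N) : dchart x x = ContinuousLinearMap.id ℝ (ES n) := by
  have : IsManifold (𝓡 n) 1 N := .of_le (n := ∞) (by simp)
  exact mfderiv_extChartAt_self

/-- The coordinate `ξ` on `Ω̂`. -/
def xi (φ : M → ℝ) (y : regularized φ) : ℝ := y.1.2

/-- The differential of the projection `π`, in preferred charts. -/
def dproj (φ : M → ℝ) [ChartedSpace (ES n) (regularized φ)] (y : regularized φ) : ES n →L[ℝ] ES n :=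
  mfderiv (𝓡 n) (𝓡 n) (proj φ) y

/-- The differential of the coordinate `ξ`, in preferred charts. -/
def dxi (φ : M → ℝ) [ChartedSpace (ES n) (regularized φ)] (y : regularized φ) : ES n →L[ℝ] ℝ :=
  mfderiv (𝓡 n) 𝓘(ℝ, ℝ) (xi φ) y

/-- The differential of `φ`, in preferred charts. -/
def dphi (φ : M → ℝ) (x : M) : ES n →L[ℝ] ℝ := mfderiv (𝓡 n) 𝓘(ℝ, ℝ) φ x

namespace AdaptedCharts

variable (h : AdaptedCharts φ v)
include h

omit [IsManifold (𝓡 n) ∞ M] in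
lemma contMDiff_val :
    ContMDiff (𝓡 n) ((𝓡 n).prod 𝓘(ℝ, ℝ)) ∞ (Subtype.val : regularized φ → M × ℝ) :=
  h.embedded.isSmoothEmbedding.contMDiff

omit [IsManifold (𝓡 n) ∞ M] in
lemma contMDiff_proj : ContMDiff (𝓡 n) (𝓡 n) ∞ (proj φ) :=
  contMDiff_fst.comp h.contMDiff_val

omit [IsManifold (𝓡 n) ∞ M] in
lemma contMDiff_xi : ContMDiff (𝓡 n) 𝓘(ℝ, ℝ) ∞ (xi φ) :=
  contMDiff_snd.comp h.contMDiff_val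

omit [IsManifold (𝓡 n) ∞ M] in
lemma hasMFDerivAt_proj (y : regularized φ) :
    HasMFDerivAt (𝓡 n) (𝓡 n) (proj φ) y (dproj φ y) :=
  ((h.contMDiff_proj y).mdifferentiableAt (by simp)).hasMFDerivAt

omit [IsManifold (𝓡 n) ∞ M] in
lemma hasMFDerivAt_xi (y : regularized φ) :
    HasMFDerivAt (𝓡 n) 𝓘(ℝ, ℝ) (xi φ) y (dxi φ y) :=
  ((h.contMDiff_xi y).mdifferentiableAt (by simp)).hasMFDerivAt

/-- Differentiate `chart_eq`. The vector `v y` belongs to the centre of the chart, which stays fixed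
as `w` varies. -/
lemma dchart_apply {y w : regularized φ} (hw : w ∈ (extChartAt (𝓡 n) y).source) (a : ES n) :
    dchart y w a = dchart y.1.1 w.1.1 (dproj φ w a) + dxi φ w a • v y := by
  have h1 : HasMFDerivAt (𝓡 n) 𝓘(ℝ, ES n) (extChartAt (𝓡 n) y.1.1) (proj φ w) _ :=
    (mdifferentiableAt_extChartAt (by
      rw [← extChartAt_source (𝓡 n)]; exact h.mem_source y w hw)).hasMFDerivAt
  have h2 := h1.comp w (h.hasMFDerivAt_proj w)
  have h3 : HasMFDerivAt 𝓘(ℝ, ℝ) 𝓘(ℝ, ES n)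
      (ContinuousLinearMap.toSpanSingleton ℝ (v y)) (xi φ w) _ :=
    (ContinuousLinearMap.toSpanSingleton ℝ (v y)).hasMFDerivAt
  have h4 := h2.add (h3.comp w (h.hasMFDerivAt_xi w))
  have h5 := h4.congr_of_eventuallyEq (f₁ := extChartAt (𝓡 n) y) (by
    filter_upwards [(isOpen_extChartAt_source (I := 𝓡 n) y).mem_nhds hw] with w' hw'
    exact h.chart_eq y w' hw')
  exact congrArg (fun T : ES n →L[ℝ] ES n => T a) h5.mfderiv

/-- At the centre of a preferred chart the differential of that chart is the identity, both on `Ω̂`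
and on `M`. -/
lemma dproj_add_dxi (y : regularized φ) (a : ES n) : dproj φ y a + dxi φ y a • v y = a := by
  have := h.embedded.isManifold
  have := h.dchart_apply (mem_extChartAt_source (I := 𝓡 n) y) a
  rw [dchart_self, dchart_self] at this
  exact this.symm

lemma dproj_eq_id {y : regularized φ} (hy : y.1.2 ≠ 0) :
    dproj φ y = ContinuousLinearMap.id ℝ (ES n) := by
  ext1 a
  have := h.dproj_add_dxi y a
  rwa [h.v_eq_zero y hy, smul_zero, add_zero] at this

-- Differentiate the equation `ξ² = 2 φ ∘ π`.
omit [IsManifold (𝓡 n) ∞ M] in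
lemma xi_mul_dxi (hφ : ContMDiff (𝓡 n) 𝓘(ℝ, ℝ) ∞ φ) (y : regularized φ) (a : ES n) :
    y.1.2 * dxi φ y a = dphi φ y.1.1 (dproj φ y a) := by
  have h1 : HasMFDerivAt (𝓡 n) 𝓘(ℝ, ℝ) φ (proj φ y) (dphi φ y.1.1) :=
    ((hφ _).mdifferentiableAt (by simp)).hasMFDerivAt
  have h2 := (h1.comp y (h.hasMFDerivAt_proj y)).const_smul (2 : ℝ)
  have h3 := (h.hasMFDerivAt_xi y).mul (h.hasMFDerivAt_xi y)
  have h4 : xi φ * xi φ = (2 : ℝ) • (φ ∘ proj φ) := by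
    funext w
    have : w.1.2 ^ 2 = 2 * φ w.1.1 := w.2
    rw [pow_two] at this
    exact this
  rw [h4] at h3
  have h5 := congrArg (fun T : ES n →L[ℝ] ℝ => T a) (h2.mfderiv.symm.trans h3.mfderiv)
  have h6 : 2 * dphi φ y.1.1 (dproj φ y a) = y.1.2 * dxi φ y a + y.1.2 * dxi φ y a := h5
  linarith

/-- The vector `ξ w + dφ(w) v` of `T Ω̂` is mapped to `(ξ w, dφ(w))` by the differential of the
inclusion `Ω̂ ⊂ M × ℝ`. -/
lemma dproj_dxi_lift (hφ : ContMDiff (𝓡 n) 𝓘(ℝ, ℝ) ∞ φ) (y : regularized φ) (w : ES n) :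
    dproj φ y (y.1.2 • w + dphi φ y.1.1 w • v y) = y.1.2 • w ∧
      dxi φ y (y.1.2 • w + dphi φ y.1.1 w • v y) = dphi φ y.1.1 w := by
  by_cases hy : y.1.2 = 0
  · have h1 : dphi φ y.1.1 (v y) = 1 := h.mfderiv_v y hy
    have h2 := h.xi_mul_dxi hφ y (v y)
    have h3 := congrArg (dphi φ y.1.1) (h.dproj_add_dxi y (v y))
    rw [hy, zero_mul] at h2
    rw [map_add, ← h2, zero_add, map_smul, h1, smul_eq_mul, mul_one] at h3
    have h4 := h.dproj_add_dxi y (v y)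
    rw [h3, one_smul, add_eq_right] at h4
    simp [hy, h3, h4]
  · have h1 := h.v_eq_zero y hy
    refine ⟨by simp [h1, h.dproj_eq_id hy], ?_⟩
    have h2 := h.xi_mul_dxi hφ y w
    rw [h.dproj_eq_id hy] at h2
    simpa [h1] using h2

lemma dxi_v (hφ : ContMDiff (𝓡 n) 𝓘(ℝ, ℝ) ∞ φ) {y : regularized φ} (hy : y.1.2 = 0) :
    dxi φ y (v y) = 1 := by
  have h1 : dphi φ y.1.1 (v y) = 1 := h.mfderiv_v y hy
  have := (h.dproj_dxi_lift hφ y (v y)).2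
  rwa [h1, hy, zero_smul, zero_add, one_smul] at this

/-- Off `Γ̂` the vector `v y` vanishes, so the chart at `y` is the chart of `M` at `π(y)` composed
with `π`. One chart followed by the inverse of the other is then a local diffeomorphism that agrees
with `π`. -/
lemma isLocalDiffeomorphAt_proj {y : regularized φ} (hy : y.1.2 ≠ 0) :
    IsLocalDiffeomorphAt (𝓡 n) (𝓡 n) ∞ (proj φ) y := by
  have := h.embedded.isManifold
  let e : OpenPartialHomeomorph (regularized φ) M :=
    (chartAt (ES n) y).trans (chartAt (ES n) y.1.1).symm
  have hsrc : ∀ w ∈ (chartAt (ES n) y).source,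
      w.1.1 ∈ (chartAt (ES n) y.1.1).source ∧ chartAt (ES n) y w = chartAt (ES n) y.1.1 w.1.1 := by
    intro w hw
    rw [← extChartAt_source (𝓡 n)] at hw
    have h1 := h.mem_source y w hw
    have h2 := h.chart_eq y w hw
    rw [h.v_eq_zero y hy, smul_zero, add_zero] at h2
    exact ⟨by rwa [extChartAt_source] at h1, h2⟩
  have he : ∀ w ∈ e.source, proj φ w = e w := by
    intro w hw
    obtain ⟨h1, h2⟩ := hsrc w hw.1
    change w.1.1 = (chartAt (ES n) y.1.1).symm (chartAt (ES n) y w)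
    rw [h2, (chartAt (ES n) y.1.1).left_inv h1]
  refine ⟨⟨e.toPartialEquiv, e.open_source, e.open_target, ?_, ?_⟩, ⟨?_, ?_⟩, he⟩
  · exact h.contMDiff_proj.contMDiffOn.congr fun w hw => (he w hw).symm
  · exact (contMDiffOn_chart_symm (x := y)).comp
      ((contMDiffOn_chart (I := 𝓡 n) (x := y.1.1)).mono fun x hx => hx.1) fun x hx => hx.2
  · exact mem_chart_source _ _
  · obtain ⟨h1, h2⟩ := hsrc y (mem_chart_source _ _)
    change chartAt (ES n) y y ∈ (chartAt (ES n) y.1.1).target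
    rw [h2]
    exact (chartAt (ES n) y.1.1).map_source h1

/-- `Γ` and `Γ̂` are hypersurfaces, and `π` restricts to a diffeomorphism between them. -/
theorem exists_diffeomorph_boundary (hφ : ContMDiff (𝓡 n) 𝓘(ℝ, ℝ) ∞ φ)
    (hdφ : ∀ x ∈ boundary φ, mfderiv (𝓡 n) 𝓘(ℝ, ℝ) φ x ≠ 0) :
    ∃ (_ : ChartedSpace (ES (n - 1)) (boundary φ))
      (_ : ChartedSpace (ES (n - 1)) (liftedBoundary φ)),
      IsEmbeddedSubmanifold (𝓡 n) (n - 1) (boundary φ) ∧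
      IsEmbeddedSubmanifold (𝓡 n) (n - 1) (liftedBoundary φ) ∧
      ∃ f : liftedBoundary φ ≃ₘ^∞⟮𝓡 (n - 1), 𝓡 (n - 1)⟯ boundary φ,
        ∀ y, (f y : M) = proj φ y := by
  have := h.embedded.isManifold
  have hk : n - 1 = Module.finrank ℝ (ES n) - Module.finrank ℝ ℝ := by
    rw [finrank_euclideanSpace_fin, Module.finrank_self]
  have hmem : ∀ y : regularized φ, y ∈ liftedBoundary φ ↔ xi φ y = 0 := fun y => mem_boundary_iff
  obtain ⟨c₁, e₁, -⟩ := exists_isEmbeddedSubmanifold_of_surjective_mfderiv hφ (0 : ℝ)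
    (S := boundary φ) (fun x => Iff.rfl)
    (fun x hx => LinearMap.surjective (f := (dphi φ x).toLinearMap) fun h0 => hdφ x hx (by
      ext a; exact LinearMap.congr_fun h0 a)) hk
  obtain ⟨c₂, e₂, -⟩ := exists_isEmbeddedSubmanifold_of_surjective_mfderiv h.contMDiff_xi (0 : ℝ)
    (S := liftedBoundary φ) hmem
    (fun y hy => LinearMap.surjective (f := (dxi φ y).toLinearMap) fun h0 => by
      have h1 : dxi φ y (v y) = 0 := LinearMap.congr_fun h0 (v y)
      rw [h.dxi_v hφ ((hmem y).1 hy)] at h1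
      exact one_ne_zero h1) hk
  refine ⟨c₁, c₂, e₁, e₂, ?_⟩
  have := e₁.isManifold
  have := e₂.isManifold
  let F : liftedBoundary φ ≃ boundary φ :=
    { toFun := fun y => ⟨proj φ y, y.2⟩
      invFun := fun x => ⟨⟨(x, 0), by
        have : φ x = 0 := x.2
        change (0 : ℝ) ^ 2 = 2 * φ x
        rw [this]; norm_num⟩, x.2⟩
      left_inv := fun y => Subtype.ext (Subtype.ext (Prod.ext rfl ((hmem y).1 y.2).symm))
      right_inv := fun x => rfl }
  refine ⟨⟨F, ?_, ?_⟩, fun y => rfl⟩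
  -- Smoothness of a map into an embedded submanifold may be tested after the inclusion. For the
  -- inverse `x ↦ (x, 0)` this is used twice, to pass through `Γ̂ ⊂ Ω̂ ⊂ M × ℝ`.
  · rw [ContMDiff.iff_comp_isImmersion e₁.isSmoothEmbedding.isImmersion]
    have h1 : ContMDiff (𝓡 (n - 1)) (𝓡 n) ∞ ((Subtype.val : boundary φ → M) ∘ F) :=
      h.contMDiff_proj.comp e₂.isSmoothEmbedding.contMDiff
    exact ⟨e₁.isSmoothEmbedding.isEmbedding.continuous_iff.2 h1.continuous, h1⟩
  · rw [ContMDiff.iff_comp_isImmersion e₂.isSmoothEmbedding.isImmersion]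
    have h1 : ContMDiff (𝓡 (n - 1)) (𝓡 n) ∞
        ((Subtype.val : liftedBoundary φ → regularized φ) ∘ F.symm) := by
      rw [ContMDiff.iff_comp_isImmersion h.embedded.isSmoothEmbedding.isImmersion]
      have h2 : ContMDiff (𝓡 (n - 1)) ((𝓡 n).prod 𝓘(ℝ, ℝ)) ∞
          ((Subtype.val : regularized φ → M × ℝ) ∘
            (Subtype.val : liftedBoundary φ → regularized φ) ∘ F.symm) :=
        e₁.isSmoothEmbedding.contMDiff.prodMk contMDiff_const
      exact ⟨h.embedded.isSmoothEmbedding.isEmbedding.continuous_iff.2 h2.continuous, h2⟩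
    exact ⟨e₂.isSmoothEmbedding.isEmbedding.continuous_iff.2 h1.continuous, h1⟩

end AdaptedCharts

end ConfigurationSpace

/-! ### Canonical charts of the cotangent bundle -/

section CotangentCharts

variable {n : ℕ} {N : Type*} [TopologicalSpace N] [ChartedSpace (ES n) N]

/-- The differential of the inverse of the preferred chart at `x₀`, at the coordinates of `x`; the
tangent space at `x` is read in the preferred chart at `x`. -/
def dchartSymm (x₀ x : N) : ES n →L[ℝ] ES n :=
  mfderiv 𝓘(ℝ, ES n) (𝓡 n) (extChartAt (𝓡 n) x₀).symm (extChartAt (𝓡 n) x₀ x)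

/-- The covector `p` of a point `(x, p)` of `T*N`, read in the preferred chart at `x`. -/
def covec (z : Cotangent n N) : ES n →L[ℝ] ℝ := z.snd

variable [IsManifold (𝓡 n) ∞ N]

lemma dchart_comp_dchartSymm {x₀ x : N} (hx : x ∈ (extChartAt (𝓡 n) x₀).source) :
    (dchart x₀ x).comp (dchartSymm x₀ x) = ContinuousLinearMap.id ℝ (ES n) := by
  have : IsManifold (𝓡 n) 1 N := .of_le (n := ∞) (by simp)
  have := mfderiv_extChartAt_comp_mfderivWithin_extChartAt_symm' (I := 𝓡 n) hx
  rw [ModelWithCorners.range_eq_univ, mfderivWithin_univ] at this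
  exact this

lemma dchartSymm_comp_dchart {x₀ x : N} (hx : x ∈ (extChartAt (𝓡 n) x₀).source) :
    (dchartSymm x₀ x).comp (dchart x₀ x) = ContinuousLinearMap.id ℝ (ES n) := by
  have : IsManifold (𝓡 n) 1 N := .of_le (n := ∞) (by simp)
  have := mfderivWithin_extChartAt_symm_comp_mfderiv_extChartAt' (I := 𝓡 n) hx
  rw [ModelWithCorners.range_eq_univ, mfderivWithin_univ] at this
  exact this

lemma dchart_dchartSymm {x₀ x : N} (hx : x ∈ (extChartAt (𝓡 n) x₀).source) (a : ES n) :
    dchart x₀ x (dchartSymm x₀ x a) = a :=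
  congrArg (fun T : ES n →L[ℝ] ES n => T a) (dchart_comp_dchartSymm hx)

lemma dchartSymm_dchart {x₀ x : N} (hx : x ∈ (extChartAt (𝓡 n) x₀).source) (a : ES n) :
    dchartSymm x₀ x (dchart x₀ x a) = a :=
  congrArg (fun T : ES n →L[ℝ] ES n => T a) (dchartSymm_comp_dchart hx)

lemma dchartSymm_self (x : N) : dchartSymm x x = ContinuousLinearMap.id ℝ (ES n) := by
  have := dchart_comp_dchartSymm (mem_extChartAt_source (I := 𝓡 n) x)
  rwa [dchart_self, ContinuousLinearMap.id_comp] at this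

lemma hasMFDerivAt_extChartAt' {x₀ x : N} (hx : x ∈ (extChartAt (𝓡 n) x₀).source) :
    HasMFDerivAt (𝓡 n) 𝓘(ℝ, ES n) (extChartAt (𝓡 n) x₀) x (dchart x₀ x) :=
  have : IsManifold (𝓡 n) 1 N := .of_le (n := ∞) (by simp)
  (mdifferentiableAt_extChartAt (by rwa [extChartAt_source] at hx)).hasMFDerivAt

lemma hasMFDerivAt_extChartAt_symm' {x₀ x : N} (hx : x ∈ (extChartAt (𝓡 n) x₀).source) :
    HasMFDerivAt 𝓘(ℝ, ES n) (𝓡 n) (extChartAt (𝓡 n) x₀).symm (extChartAt (𝓡 n) x₀ x)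
      (dchartSymm x₀ x) :=
  (((contMDiffOn_extChartAt_symm (I := 𝓡 n) (n := ∞) x₀).contMDiffAt
    ((isOpen_extChartAt_target x₀).mem_nhds ((extChartAt (𝓡 n) x₀).map_source hx))).mdifferentiableAt
      (by simp)).hasMFDerivAt

lemma symmL_trivializationAt_eq {x₀ x : N} (hx : x ∈ (extChartAt (𝓡 n) x₀).source) :
    (trivializationAt (ES n) (TangentSpace (𝓡 n)) x₀).symmL ℝ x = dchartSymm x₀ x := by
  have : IsManifold (𝓡 n) 1 N := .of_le (n := ∞) (by simp)
  rw [extChartAt_source] at hx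
  have h := TangentBundle.symmL_trivializationAt (I := 𝓡 n) hx
  rw [ModelWithCorners.range_eq_univ, mfderivWithin_univ] at h
  exact h

lemma mem_cotangent_chart_source {z₀ z : Cotangent n N} :
    z ∈ (extChartAt (cotangentModel n) z₀).source ↔
      z.proj ∈ (extChartAt (𝓡 n) z₀.proj).source := by
  rw [extChartAt_source, extChartAt_source, FiberBundle.chartedSpace_chartAt]
  simp
  intro h
  exact h

/-- This identifies the bundle charts with canonical coordinates: the trivialization acts on
covectors by composition with the inverse differential of the chart of the base. -/
lemma extChartAt_cotangent {z₀ z : Cotangent n N}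
    (h : z.proj ∈ (extChartAt (𝓡 n) z₀.proj).source) :
    extChartAt (cotangentModel n) z₀ z =
      (extChartAt (𝓡 n) z₀.proj z.proj, (covec z).comp (dchartSymm z₀.proj z.proj)) := by
  rw [← symmL_trivializationAt_eq h, FiberBundle.extChartAt]
  simp [hom_trivializationAt_apply, ContinuousLinearMap.inCoordinates]
  rfl

lemma extChartAt_cotangent_self (z : Cotangent n N) :
    extChartAt (cotangentModel n) z z = (extChartAt (𝓡 n) z.proj z.proj, covec z) := by
  rw [extChartAt_cotangent (mem_extChartAt_source _), dchartSymm_self]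
  rfl

/-- The point of `T*N` with coordinates `(u, P)` in the canonical chart over `x₀`. -/
def ofCoords (x₀ : N) (a : ES n × (ES n →L[ℝ] ℝ)) : Cotangent n N :=
  ⟨(extChartAt (𝓡 n) x₀).symm a.1,
    (a.2.comp (dchart x₀ ((extChartAt (𝓡 n) x₀).symm a.1)) : ES n →L[ℝ] ℝ)⟩

lemma extChartAt_ofCoords {z₀ : Cotangent n N} {a : ES n × (ES n →L[ℝ] ℝ)}
    (ha : a.1 ∈ (extChartAt (𝓡 n) z₀.proj).target) :
    extChartAt (cotangentModel n) z₀ (ofCoords z₀.proj a) = a := by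
  have h := (extChartAt (𝓡 n) z₀.proj).map_target ha
  rw [extChartAt_cotangent h]
  refine Prod.ext ((extChartAt (𝓡 n) z₀.proj).right_inv ha) ?_
  change (a.2.comp (dchart _ _)).comp (dchartSymm _ _) = a.2
  rw [ContinuousLinearMap.comp_assoc, ofCoords, dchart_comp_dchartSymm h,
    ContinuousLinearMap.comp_id]

lemma mem_cotangent_chart_target {z₀ : Cotangent n N} {a : ES n × (ES n →L[ℝ] ℝ)} :
    a ∈ (extChartAt (cotangentModel n) z₀).target ↔
      a.1 ∈ (extChartAt (𝓡 n) z₀.proj).target := by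
  constructor
  · intro h
    have h1 := (extChartAt (cotangentModel n) z₀).map_target h
    have h2 := mem_cotangent_chart_source.1 h1
    have h3 := extChartAt_cotangent h2
    rw [(extChartAt (cotangentModel n) z₀).right_inv h] at h3
    rw [h3]
    exact (extChartAt (𝓡 n) z₀.proj).map_source h2
  · intro h
    rw [← extChartAt_ofCoords h]
    exact (extChartAt (cotangentModel n) z₀).map_source
      (mem_cotangent_chart_source.2 ((extChartAt (𝓡 n) z₀.proj).map_target h))

lemma extChartAt_cotangent_symm {z₀ : Cotangent n N} {a : ES n × (ES n →L[ℝ] ℝ)}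
    (ha : a.1 ∈ (extChartAt (𝓡 n) z₀.proj).target) :
    (extChartAt (cotangentModel n) z₀).symm a = ofCoords z₀.proj a := by
  have h : ofCoords z₀.proj a ∈ (extChartAt (cotangentModel n) z₀).source :=
    mem_cotangent_chart_source.2 ((extChartAt (𝓡 n) z₀.proj).map_target ha)
  rw [← (extChartAt (cotangentModel n) z₀).left_inv h, extChartAt_ofCoords ha]

end CotangentCharts

/-! ### Linear symplectic algebra and cotangent lifts -/

section Symplectic

variable {n : ℕ}

/-- The Hamiltonian vector determined by a differential in canonical coordinates. -/
def hamVec (D : (ES n × (ES n →L[ℝ] ℝ)) →L[ℝ] ℝ) : ES n × (ES n →L[ℝ] ℝ) :=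
  (WithLp.toLp 2 fun i => D (0, EuclideanSpace.proj i),
    -(D.comp (ContinuousLinearMap.inl ℝ (ES n) (ES n →L[ℝ] ℝ))))

/-- The components of `(hamVec D).1` are the values of `D` on the coordinate covectors, so expanding
`q` in these covectors gives the formula for every `q`. -/
lemma apply_hamVec_fst (D : (ES n × (ES n →L[ℝ] ℝ)) →L[ℝ] ℝ) (q : ES n →L[ℝ] ℝ) :
    q (hamVec D).1 = D (0, q) := by
  have hq : q = ∑ i, q (EuclideanSpace.single i 1) • EuclideanSpace.proj (𝕜 := ℝ) i := by
    ext a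
    conv_lhs => rw [← (EuclideanSpace.basisFun (Fin n) ℝ).sum_repr a, map_sum]
    simp [mul_comm]
  have h2 : ((0, q) : ES n × (ES n →L[ℝ] ℝ)) = ContinuousLinearMap.inr ℝ _ _ q := rfl
  conv_lhs => rw [hq]
  conv_rhs => rw [h2, hq, map_sum, map_sum]
  simp only [sum_apply, smul_apply, map_smul]
  rfl

lemma hamVec_snd_apply (D : (ES n × (ES n →L[ℝ] ℝ)) →L[ℝ] ℝ) (a : ES n) :
    (hamVec D).2 a = -D (a, 0) := rfl

/-- The canonical symplectic form, `ω(X, Y) = q_Y(a_X) - q_X(a_Y)` for `X = (a_X, q_X)`. -/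
def sympl (X Y : ES n × (ES n →L[ℝ] ℝ)) : ℝ := Y.2 X.1 - X.2 Y.1

lemma sympl_hamVec (D : (ES n × (ES n →L[ℝ] ℝ)) →L[ℝ] ℝ) (Y : ES n × (ES n →L[ℝ] ℝ)) :
    sympl (hamVec D) Y = D Y := by
  rw [sympl, apply_hamVec_fst, hamVec_snd_apply, sub_neg_eq_add, ← map_add]
  simp

lemma eq_zero_of_sympl_eq_zero {X : ES n × (ES n →L[ℝ] ℝ)} (h : ∀ Y, sympl X Y = 0) : X = 0 := by
  refine Prod.ext ?_ ?_
  · ext i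
    simpa [sympl] using h (0, EuclideanSpace.proj i)
  · ext1 a
    simpa [sympl] using h (a, 0)

lemma eq_hamVec_of_sympl {D : (ES n × (ES n →L[ℝ] ℝ)) →L[ℝ] ℝ} {X : ES n × (ES n →L[ℝ] ℝ)}
    (h : ∀ Y, sympl X Y = D Y) : X = hamVec D := by
  rw [← sub_eq_zero]
  refine eq_zero_of_sympl_eq_zero fun Y => ?_
  have h1 := h Y
  rw [← sympl_hamVec D Y] at h1
  simp only [sympl, Prod.fst_sub, Prod.snd_sub, map_sub, sub_apply] at h1 ⊢
  linarith

lemma apply_hamVec_self (D : (ES n × (ES n →L[ℝ] ℝ)) →L[ℝ] ℝ) : D (hamVec D) = 0 := by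
  rw [← sympl_hamVec, sympl, sub_self]

/-- A linear symplectic map carries Hamiltonian vectors to Hamiltonian vectors. -/
lemma map_hamVec_of_sympl
    {T : (ES n × (ES n →L[ℝ] ℝ)) →L[ℝ] ES n × (ES n →L[ℝ] ℝ)}
    (hT : ∀ X Y, sympl (T X) (T Y) = sympl X Y) (D : (ES n × (ES n →L[ℝ] ℝ)) →L[ℝ] ℝ) :
    T (hamVec (D.comp T)) = hamVec D := by
  have hinj : Function.Injective T.toLinearMap := by
    rw [← LinearMap.ker_eq_bot, LinearMap.ker_eq_bot']
    intro X hX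
    refine eq_zero_of_sympl_eq_zero fun Y => ?_
    have hX' : T X = 0 := hX
    rw [← hT, hX']
    simp [sympl]
  have hsurj := LinearMap.surjective_of_injective hinj
  refine eq_hamVec_of_sympl fun Y => ?_
  obtain ⟨Y', rfl⟩ := hsurj Y
  exact (hT _ _).trans (sympl_hamVec _ _)

/-- The cotangent lift `(u, P) ↦ (K(u), P ∘ DK'(K(u)))` of a local diffeomorphism `K` with local
inverse `K'` is symplectic. -/
lemma exists_hasFDerivAt_cotangentLift {K K' : ES n → ES n} {a : ES n × (ES n →L[ℝ] ℝ)}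
    {L : ES n →L[ℝ] ES n} (hK : HasFDerivAt K L a.1) (hK' : ContDiffAt ℝ ∞ K' (K a.1))
    (hL : (fderiv ℝ K' (K a.1)).comp L = ContinuousLinearMap.id ℝ (ES n)) :
    ∃ T : (ES n × (ES n →L[ℝ] ℝ)) →L[ℝ] ES n × (ES n →L[ℝ] ℝ),
      HasFDerivAt (fun b : ES n × (ES n →L[ℝ] ℝ) => (K b.1, b.2.comp (fderiv ℝ K' (K b.1)))) T a ∧
      ∀ X Y, sympl (T X) (T Y) = sympl X Y := by
  have h1 : HasFDerivAt (fun b : ES n × (ES n →L[ℝ] ℝ) => K b.1)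
      (L.comp (ContinuousLinearMap.fst ℝ _ _)) a := hK.comp a hasFDerivAt_fst
  have h2 : HasFDerivAt (fderiv ℝ K') (fderiv ℝ (fderiv ℝ K') (K a.1)) (K a.1) :=
    ((hK'.fderiv_right (m := 1) (WithTop.coe_le_coe.2 le_top)).differentiableAt (by simp)).hasFDerivAt
  have h3 := (hasFDerivAt_snd (𝕜 := ℝ) (p := a)).clm_comp (h2.comp a h1)
  refine ⟨_, h1.prodMk h3, ?_⟩
  -- The derivative of the momentum component contains a term with `D²K'`. It enters the symplectic
  -- form antisymmetrized, hence drops out.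
  have hsymm : IsSymmSndFDerivAt ℝ K' (K a.1) :=
    hK'.isSymmSndFDerivAt (by simpa using WithTop.coe_le_coe.2 (le_top (a := (2 : ℕ∞))))
  intro X Y
  have hLX : ∀ x, fderiv ℝ K' (K a.1) (L x) = x := fun x =>
    congrArg (fun T : ES n →L[ℝ] ES n => T x) hL
  have := hsymm (L X.1) (L Y.1)
  simp [sympl, hLX, this]

end Symplectic

/-! ### Hamilton's equations in a fixed chart -/

section Hamilton

variable {n : ℕ} {N : Type*} [TopologicalSpace N] [ChartedSpace (ES n) N] [IsManifold (𝓡 n) ∞ N]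

/-- The differential of a function on `T*N`, in preferred charts. -/
def dham (H : Cotangent n N → ℝ) (z : Cotangent n N) : (ES n × (ES n →L[ℝ] ℝ)) →L[ℝ] ℝ :=
  mfderiv (cotangentModel n) 𝓘(ℝ, ℝ) H z

lemma dchart_eq_fderiv_comp {x₀ x₁ x : N} (h₀ : x ∈ (extChartAt (𝓡 n) x₀).source)
    (h₁ : x ∈ (extChartAt (𝓡 n) x₁).source) :
    dchart x₁ x = (fderiv ℝ (extChartAt (𝓡 n) x₁ ∘ (extChartAt (𝓡 n) x₀).symm)
      (extChartAt (𝓡 n) x₀ x)).comp (dchart x₀ x) := by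
  have h2 : HasMFDerivAt (𝓡 n) 𝓘(ℝ, ES n) (extChartAt (𝓡 n) x₁)
      ((extChartAt (𝓡 n) x₀).symm (extChartAt (𝓡 n) x₀ x)) (dchart x₁ x) := by
    rw [(extChartAt (𝓡 n) x₀).left_inv h₀]
    exact hasMFDerivAt_extChartAt' h₁
  have h3 : HasFDerivAt (extChartAt (𝓡 n) x₁ ∘ (extChartAt (𝓡 n) x₀).symm)
      ((dchart x₁ x).comp (dchartSymm x₀ x)) (extChartAt (𝓡 n) x₀ x) :=
    (h2.comp _ (hasMFDerivAt_extChartAt_symm' h₀)).hasFDerivAt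
  have h4 := h3.fderiv
  rw [h4, ContinuousLinearMap.comp_assoc, dchartSymm_comp_dchart h₀, ContinuousLinearMap.comp_id]

lemma contDiffAt_chart_comp_symm {x₀ x₁ x : N} (h₀ : x ∈ (extChartAt (𝓡 n) x₀).source)
    (h₁ : x ∈ (extChartAt (𝓡 n) x₁).source) :
    ContDiffAt ℝ ∞ (extChartAt (𝓡 n) x₁ ∘ (extChartAt (𝓡 n) x₀).symm)
      (extChartAt (𝓡 n) x₀ x) := by
  rw [← contMDiffAt_iff_contDiffAt]
  refine ContMDiffAt.comp _ ?_ ((contMDiffOn_extChartAt_symm (I := 𝓡 n) (n := ∞) x₀).contMDiffAt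
    ((isOpen_extChartAt_target x₀).mem_nhds ((extChartAt (𝓡 n) x₀).map_source h₀)))
  rw [(extChartAt (𝓡 n) x₀).left_inv h₀]
  exact contMDiffAt_extChartAt' (by rwa [extChartAt_source] at h₁)

/-- The change between two canonical charts of `T*N` is symplectic. -/
lemma exists_hasFDerivAt_cotangent_chart_change {z₀ z₁ : Cotangent n N}
    (h : z₁.proj ∈ (extChartAt (𝓡 n) z₀.proj).source) :
    ∃ T : (ES n × (ES n →L[ℝ] ℝ)) →L[ℝ] ES n × (ES n →L[ℝ] ℝ),
      HasFDerivAt (extChartAt (cotangentModel n) z₀ ∘ (extChartAt (cotangentModel n) z₁).symm) T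
        (extChartAt (cotangentModel n) z₁ z₁) ∧ ∀ X Y, sympl (T X) (T Y) = sympl X Y := by
  set x₀ := z₀.proj
  set x₁ := z₁.proj with hx₁
  have h₁ : x₁ ∈ (extChartAt (𝓡 n) x₁).source := mem_extChartAt_source x₁
  have ha : (extChartAt (cotangentModel n) z₁ z₁).1 = extChartAt (𝓡 n) x₁ x₁ := by
    rw [extChartAt_cotangent_self]
  have hinv : (extChartAt (𝓡 n) x₁).symm (extChartAt (𝓡 n) x₁ x₁) = x₁ :=
    (extChartAt (𝓡 n) x₁).left_inv h₁
  -- The change of canonical charts is the cotangent lift of the change `K` of base charts, and `K'`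
  -- is the opposite change.
  obtain ⟨T, hT, hT'⟩ := exists_hasFDerivAt_cotangentLift
    (K := extChartAt (𝓡 n) x₀ ∘ (extChartAt (𝓡 n) x₁).symm)
    (K' := extChartAt (𝓡 n) x₁ ∘ (extChartAt (𝓡 n) x₀).symm)
    (a := extChartAt (cotangentModel n) z₁ z₁)
    (L := fderiv ℝ (extChartAt (𝓡 n) x₀ ∘ (extChartAt (𝓡 n) x₁).symm) (extChartAt (𝓡 n) x₁ x₁))
    (by
      rw [ha]
      exact ((contDiffAt_chart_comp_symm h₁ h).differentiableAt (by simp)).hasFDerivAt)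
    (by
      rw [ha, Function.comp_apply, hinv]
      exact contDiffAt_chart_comp_symm h h₁)
    (by
      rw [ha, Function.comp_apply, hinv]
      have h2 := dchart_eq_fderiv_comp (x₁ := x₀) h₁ h
      rw [dchart_self, ContinuousLinearMap.comp_id] at h2
      rw [← h2, ← dchart_eq_fderiv_comp h h₁, dchart_self])
  refine ⟨T, hT.congr_of_eventuallyEq ?_, hT'⟩
  have h3 : ∀ᶠ a : ES n × (ES n →L[ℝ] ℝ) in 𝓝 (extChartAt (cotangentModel n) z₁ z₁),
      a.1 ∈ (extChartAt (𝓡 n) x₁).target ∩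
        (extChartAt (𝓡 n) x₁).symm ⁻¹' (extChartAt (𝓡 n) x₀).source := by
    refine continuous_fst.continuousAt.eventually (IsOpen.mem_nhds ?_ ?_)
    · exact (continuousOn_extChartAt_symm x₁).isOpen_inter_preimage (isOpen_extChartAt_target x₁)
        (isOpen_extChartAt_source x₀)
    · rw [ha]
      exact ⟨mem_extChartAt_target x₁, by rw [Set.mem_preimage, hinv]; exact h⟩
  filter_upwards [h3] with a ⟨ha1, ha2⟩
  have ha2 : (extChartAt (𝓡 n) x₁).symm a.1 ∈ (extChartAt (𝓡 n) x₀).source := ha2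
  rw [Function.comp_apply, extChartAt_cotangent_symm ha1, extChartAt_cotangent ha2]
  refine Prod.ext rfl ?_
  change (a.2.comp (dchart x₁ ((extChartAt (𝓡 n) x₁).symm a.1))).comp
    (dchartSymm x₀ ((extChartAt (𝓡 n) x₁).symm a.1)) = _
  rw [ContinuousLinearMap.comp_assoc,
    dchart_eq_fderiv_comp ha2 ((extChartAt (𝓡 n) x₁).map_target ha1),
    ContinuousLinearMap.comp_assoc]
  rw [dchart_comp_dchartSymm ha2]
  rfl

/-- Hamilton's equations in a fixed canonical chart. -/
lemma IsTrajectoryOn.hasDerivAt_extChartAt {H : Cotangent n N → ℝ} {z : ℝ → Cotangent n N}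
    {J : Set ℝ} (hz : IsTrajectoryOn H z J) (hH : MDifferentiable (cotangentModel n) 𝓘(ℝ, ℝ) H)
    {s : ℝ} (hs : s ∈ J) {z₀ : Cotangent n N}
    (h : (z s).proj ∈ (extChartAt (𝓡 n) z₀.proj).source) :
    HasDerivAt (fun t => extChartAt (cotangentModel n) z₀ (z t))
      (hamVec (fderiv ℝ (H ∘ (extChartAt (cotangentModel n) z₀).symm)
        (extChartAt (cotangentModel n) z₀ (z s)))) s := by
  set z₁ := z s with hz₁
  -- The definition of a trajectory gives its velocity at time `s` in the preferred chart at `z s`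
  -- itself. The symplectic differential `T` carries it to the fixed chart at `z₀`.
  obtain ⟨T, hT, hT'⟩ := exists_hasFDerivAt_cotangent_chart_change h
  have hm : HasMFDerivAt 𝓘(ℝ, ℝ) (cotangentModel n) z s
      ((1 : ℝ →L[ℝ] ℝ).smulRight (hamiltonianField H z₁)) :=
    (hz.2 s hs).hasMFDerivAt (hz.1.mem_nhds hs)
  have hd : HasDerivAt (fun t => extChartAt (cotangentModel n) z₁ (z t))
      (hamVec (dham H z₁)) s := by
    have h1 := hm.2
    rw [ModelWithCorners.range_eq_univ] at h1
    have h2 : HasFDerivAt (E := ℝ) (F := ES n × (ES n →L[ℝ] ℝ))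
        (fun t => extChartAt (cotangentModel n) z₁ (z t))
        ((1 : ℝ →L[ℝ] ℝ).smulRight (hamVec (dham H z₁))) s :=
      hasFDerivWithinAt_univ.1 h1
    refine h2.hasDerivAt.congr_deriv ?_
    exact one_smul ℝ (hamVec (dham H z₁))
  have hsrc : z₁ ∈ (extChartAt (cotangentModel n) z₀).source := mem_cotangent_chart_source.2 h
  have heq : (fun t => extChartAt (cotangentModel n) z₀ (z t)) =ᶠ[𝓝 s]
      (extChartAt (cotangentModel n) z₀ ∘ (extChartAt (cotangentModel n) z₁).symm) ∘
        (fun t => extChartAt (cotangentModel n) z₁ (z t)) := by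
    filter_upwards [hm.1.preimage_mem_nhds (extChartAt_source_mem_nhds (I := cotangentModel n) z₁)]
      with t ht
    simp only [Function.comp_apply]
    rw [(extChartAt (cotangentModel n) z₁).left_inv ht]
  have hinv : (extChartAt (cotangentModel n) z₁).symm (extChartAt (cotangentModel n) z₁ z₁) = z₁ :=
    (extChartAt (cotangentModel n) z₁).left_inv (mem_extChartAt_source z₁)
  refine ((hT.comp_hasDerivAt s hd).congr_of_eventuallyEq heq).congr_deriv ?_
  have hH₀ : DifferentiableAt ℝ (H ∘ (extChartAt (cotangentModel n) z₀).symm)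
      (extChartAt (cotangentModel n) z₀ z₁) := by
    rw [← mdifferentiableAt_iff_differentiableAt]
    refine (hH _).comp _ ((contMDiffOn_extChartAt_symm (I := cotangentModel n) (n := ∞)
      z₀).contMDiffAt ?_ |>.mdifferentiableAt (by simp))
    exact (isOpen_extChartAt_target z₀).mem_nhds
      ((extChartAt (cotangentModel n) z₀).map_source hsrc)
  -- By the chain rule the differential in the chart at `z₁` is the differential in the chart at
  -- `z₀` composed with `T`; this is the form that `map_hamVec_of_sympl` needs.
  have hcomp : HasFDerivAt (H ∘ (extChartAt (cotangentModel n) z₁).symm)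
      ((fderiv ℝ (H ∘ (extChartAt (cotangentModel n) z₀).symm)
        (extChartAt (cotangentModel n) z₀ z₁)).comp T) (extChartAt (cotangentModel n) z₁ z₁) := by
    have h1 : HasFDerivAt (H ∘ (extChartAt (cotangentModel n) z₀).symm)
        (fderiv ℝ (H ∘ (extChartAt (cotangentModel n) z₀).symm)
          (extChartAt (cotangentModel n) z₀ z₁))
        ((extChartAt (cotangentModel n) z₀ ∘ (extChartAt (cotangentModel n) z₁).symm)
          (extChartAt (cotangentModel n) z₁ z₁)) := by
      rw [Function.comp_apply, hinv]
      exact hH₀.hasFDerivAt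
    refine (h1.comp _ hT).congr_of_eventuallyEq ?_
    have hc := continuousAt_extChartAt_symm (I := cotangentModel n) z₁
    rw [ContinuousAt, extChartAt_to_inv] at hc
    filter_upwards [hc.eventually ((isOpen_extChartAt_source z₀).mem_nhds hsrc)] with a ha
    simp only [Function.comp_apply]
    rw [(extChartAt (cotangentModel n) z₀).left_inv ha]
  have hH₁ : HasFDerivAt (E := ES n × (ES n →L[ℝ] ℝ)) (F := ℝ)
      (H ∘ (extChartAt (cotangentModel n) z₁).symm) (dham H z₁)
      (extChartAt (cotangentModel n) z₁ z₁) := hasFDerivAt_comp_extChartAt_symm (hH z₁)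
  have hD := hH₁.unique hcomp
  rw [hD, map_hamVec_of_sympl hT']

end Hamilton

/-! ### The metric in coordinates and smoothness of `H` -/

section Gram

variable {n : ℕ} {N : Type*} [TopologicalSpace N] [ChartedSpace (ES n) N] [IsManifold (𝓡 n) ∞ N]
  (g : Bundle.ContMDiffRiemannianMetric (𝓡 n) ∞ (ES n) (fun x : N => TangentSpace (𝓡 n) x))

/-- The value `P(A⁻¹ P)` of the quadratic form dual to `A` on the covector `P`. -/
def dualForm (A : ES n →L[ℝ] ES n →L[ℝ] ℝ) (P : ES n →L[ℝ] ℝ) : ℝ := P (A.inverse P)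

lemma dualForm_eq {A : ES n →L[ℝ] ES n →L[ℝ] ℝ} (hA : A.IsInvertible) (a : ES n) :
    dualForm A (A a) = A a a := by
  obtain ⟨e, rfl⟩ := hA
  simp [dualForm]

lemma dualForm_smul (A : ES n →L[ℝ] ES n →L[ℝ] ℝ) (t : ℝ) (P : ES n →L[ℝ] ℝ) :
    dualForm A (t • P) = t ^ 2 * dualForm A P := by
  simp [dualForm]
  ring

lemma finrank_covectors : Module.finrank ℝ (ES n →L[ℝ] ℝ) = n := by
  rw [← (LinearMap.toContinuousLinearMap (𝕜 := ℝ) (E := ES n) (F' := ℝ)).finrank_eq]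
  exact Subspace.dual_finrank_eq.trans finrank_euclideanSpace_fin

lemma isInvertible_of_pos {A : ES n →L[ℝ] ES n →L[ℝ] ℝ} (hA : ∀ a, a ≠ 0 → 0 < A a a) :
    A.IsInvertible := by
  have hinj : Function.Injective A.toLinearMap := by
    rw [← LinearMap.ker_eq_bot, LinearMap.ker_eq_bot']
    intro a ha
    by_contra h0
    have h1 := hA a h0
    have h2 : A a = 0 := ha
    simp [h2] at h1
  exact ⟨(LinearEquiv.ofInjectiveOfFinrankEq A.toLinearMap hinj
    (by rw [finrank_covectors, finrank_euclideanSpace_fin])).toContinuousLinearEquiv, by ext; rfl⟩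

/-- The metric as a bilinear form on the model space, in the preferred chart at `x`. -/
def gram (x : N) : ES n →L[ℝ] ES n →L[ℝ] ℝ := g.inner x

/-- The metric at `x`, in the preferred chart at `x₀`. -/
def gramIn (x₀ x : N) : ES n →L[ℝ] ES n →L[ℝ] ℝ :=
  (gram g x).bilinearComp (dchartSymm x₀ x) (dchartSymm x₀ x)

lemma gram_pos (x : N) (a : ES n) (ha : a ≠ 0) : 0 < gram g x a a := g.pos x a ha

lemma gram_symm (x : N) (a b : ES n) : gram g x a b = gram g x b a := g.symm x a b

lemma gramIn_pos {x₀ x : N} (hx : x ∈ (extChartAt (𝓡 n) x₀).source) (a : ES n) (ha : a ≠ 0) :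
    0 < gramIn g x₀ x a a := by
  refine gram_pos g x _ fun h0 => ha ?_
  have h1 := dchart_dchartSymm hx a
  have h0' : dchartSymm x₀ x a = 0 := h0
  rw [← h1, h0', map_zero]

lemma conormSq_eq (z : Cotangent n N) : conormSq g z = dualForm (gram g z.proj) (covec z) := rfl

/-- Write `p = g(a, ·)`. Both sides equal `g(a, a)`, whatever the coordinates. -/
lemma dualForm_gram {x₀ x : N} (hx : x ∈ (extChartAt (𝓡 n) x₀).source) (p : ES n →L[ℝ] ℝ) :
    dualForm (gram g x) p = dualForm (gramIn g x₀ x) (p.comp (dchartSymm x₀ x)) := by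
  have hA := isInvertible_of_pos (gram_pos g x)
  obtain ⟨a, rfl⟩ : ∃ a, gram g x a = p := by
    obtain ⟨e, he⟩ := hA
    exact ⟨e.symm p, by rw [← he]; simp⟩
  have h1 : (gram g x a).comp (dchartSymm x₀ x) = gramIn g x₀ x (dchart x₀ x a) := by
    ext1 b
    change _ = gram g x (dchartSymm x₀ x (dchart x₀ x a)) _
    rw [dchartSymm_dchart hx]
    rfl
  rw [h1, dualForm_eq hA, dualForm_eq (isInvertible_of_pos (gramIn_pos g hx))]
  change _ = gram g x (dchartSymm x₀ x (dchart x₀ x a)) (dchartSymm x₀ x (dchart x₀ x a))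
  rw [dchartSymm_dchart hx]

/-- Smoothness of `g` as a section of a bundle of bilinear forms is smoothness in trivializations,
which act on vectors through the inverse differential of the chart. The centre of the chart
suffices, since smoothness is checked one point at a time. -/
lemma contMDiffAt_gramIn (x₀ : N) :
    ContMDiffAt (𝓡 n) 𝓘(ℝ, ES n →L[ℝ] ES n →L[ℝ] ℝ) ∞ (gramIn g x₀) x₀ := by
  have : IsManifold (𝓡 n) 1 N := .of_le (n := ∞) (by simp)
  have h := (contMDiffAt_hom_bundle _).1 (g.contMDiff x₀)
  refine h.2.congr_of_eventuallyEq ?_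
  filter_upwards [extChartAt_source_mem_nhds (I := 𝓡 n) x₀] with x hx
  ext a b
  have hx' : x ∈ (trivializationAt (ES n) (TangentSpace (𝓡 n)) x₀).baseSet := by
    rwa [extChartAt_source] at hx
  refine Eq.trans ?_ (inCoordinates_apply_eq₂ (E₃ := Bundle.Trivial N ℝ) (F₃ := ℝ) (v := a) (w := b)
    (ϕ := g.inner x) hx' hx' trivial).symm
  have h1 : ∀ a, (trivializationAt (ES n) (TangentSpace (𝓡 n)) x₀).symm x a = dchartSymm x₀ x a :=
    fun a => (Bundle.Trivialization.symmL_apply (R := ℝ) _ hx' a).symm.trans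
      (congrArg (fun T : ES n →L[ℝ] ES n => T a) (symmL_trivializationAt_eq hx))
  rw [h1, h1]
  simp
  rfl

/-- Inversion of operators is smooth near an invertible one. -/
lemma contMDiffAt_dualForm {E' H' N' : Type*} [NormedAddCommGroup E'] [NormedSpace ℝ E']
    [TopologicalSpace H'] {I : ModelWithCorners ℝ E' H'} [TopologicalSpace N'] [ChartedSpace H' N']
    {A : N' → ES n →L[ℝ] ES n →L[ℝ] ℝ} {P : N' → ES n →L[ℝ] ℝ} {z : N'}
    (hA : ContMDiffAt I 𝓘(ℝ, ES n →L[ℝ] ES n →L[ℝ] ℝ) ∞ A z)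
    (hP : ContMDiffAt I 𝓘(ℝ, ES n →L[ℝ] ℝ) ∞ P z) (hAz : (A z).IsInvertible) :
    ContMDiffAt I 𝓘(ℝ, ℝ) ∞ (fun w => dualForm (A w) (P w)) z := by
  obtain ⟨e, he⟩ := hAz
  have h1 : ContDiffAt ℝ ∞ ContinuousLinearMap.inverse (A z) := he ▸ contDiffAt_map_inverse e
  exact hP.clm_apply ((h1.contMDiffAt.comp z hA).clm_apply hP)


lemma dphi_comp_dchartSymm {φ : N → ℝ} (hφ : ContMDiff (𝓡 n) 𝓘(ℝ, ℝ) ∞ φ) {x₀ x : N}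
    (hx : x ∈ (extChartAt (𝓡 n) x₀).source) :
    (dphi φ x).comp (dchartSymm x₀ x) =
      fderiv ℝ (φ ∘ (extChartAt (𝓡 n) x₀).symm) (extChartAt (𝓡 n) x₀ x) := by
  have h1 : HasMFDerivAt (𝓡 n) 𝓘(ℝ, ℝ) φ
      ((extChartAt (𝓡 n) x₀).symm (extChartAt (𝓡 n) x₀ x)) (dphi φ x) := by
    rw [(extChartAt (𝓡 n) x₀).left_inv hx]
    exact ((hφ x).mdifferentiableAt (by simp)).hasMFDerivAt
  have h2 : HasFDerivAt (φ ∘ (extChartAt (𝓡 n) x₀).symm)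
      ((dphi φ x).comp (dchartSymm x₀ x)) (extChartAt (𝓡 n) x₀ x) :=
    (h1.comp _ (hasMFDerivAt_extChartAt_symm' hx)).hasFDerivAt
  exact h2.fderiv.symm

lemma contDiffOn_comp_extChartAt_symm {φ : N → ℝ} (hφ : ContMDiff (𝓡 n) 𝓘(ℝ, ℝ) ∞ φ) (x₀ : N) :
    ContDiffOn ℝ ∞ (φ ∘ (extChartAt (𝓡 n) x₀).symm) (extChartAt (𝓡 n) x₀).target :=
  contMDiffOn_iff_contDiffOn.1 (hφ.comp_contMDiffOn (contMDiffOn_extChartAt_symm x₀))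

lemma contMDiffAt_dphi_comp_dchartSymm {φ : N → ℝ} (hφ : ContMDiff (𝓡 n) 𝓘(ℝ, ℝ) ∞ φ) (x₀ : N) :
    ContMDiffAt (𝓡 n) 𝓘(ℝ, ES n →L[ℝ] ℝ) ∞
      (fun x => (dphi φ x).comp (dchartSymm (n := n) x₀ x)) x₀ := by
  have h1 : ContDiffAt ℝ ∞ (fderiv ℝ (φ ∘ (extChartAt (𝓡 n) x₀).symm)) (extChartAt (𝓡 n) x₀ x₀) :=
    ((contDiffOn_comp_extChartAt_symm hφ x₀).contDiffAt
      (extChartAt_target_mem_nhds (I := 𝓡 n) x₀)).fderiv_right (by simp)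
  have h2 : ContMDiffAt (𝓡 n) 𝓘(ℝ, ES n →L[ℝ] ℝ) ∞
      (fderiv ℝ (φ ∘ (extChartAt (𝓡 n) x₀).symm) ∘ extChartAt (𝓡 n) x₀) x₀ :=
    h1.contMDiffAt.comp x₀ contMDiffAt_extChartAt
  refine h2.congr_of_eventuallyEq ?_
  filter_upwards [extChartAt_source_mem_nhds (I := 𝓡 n) x₀] with x hx
  exact dphi_comp_dchartSymm hφ hx

/-- The momentum coordinates of the canonical chart of `T*N` at `z₀`. -/
lemma contMDiffAt_covec_comp_dchartSymm (z₀ : Cotangent n N) :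
    ContMDiffAt (cotangentModel n) 𝓘(ℝ, ES n →L[ℝ] ℝ) ∞
      (fun z : Cotangent n N => (covec z).comp (dchartSymm z₀.proj z.proj)) z₀ := by
  have h1 : ContMDiffAt (cotangentModel n) 𝓘(ℝ, ES n × (ES n →L[ℝ] ℝ)) ∞
      (extChartAt (cotangentModel n) z₀) z₀ := contMDiffAt_extChartAt
  refine (contDiff_snd.contMDiff.contMDiffAt.comp z₀ h1).congr_of_eventuallyEq ?_
  filter_upwards [extChartAt_source_mem_nhds (I := cotangentModel n) z₀] with z hz
  rw [Function.comp_apply, extChartAt_cotangent (mem_cotangent_chart_source.1 hz)]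

lemma contMDiff_cotangent_proj :
    ContMDiff (cotangentModel n) (𝓡 n) ∞ (fun z : Cotangent n N => z.proj) :=
  Bundle.contMDiff_proj _

lemma contMDiff_conormSq : ContMDiff (cotangentModel n) 𝓘(ℝ, ℝ) ∞ (conormSq g) := by
  intro z₀
  have h1 := contMDiffAt_dualForm ((contMDiffAt_gramIn g z₀.proj).comp z₀
    (contMDiff_cotangent_proj z₀)) (contMDiffAt_covec_comp_dchartSymm z₀)
    (isInvertible_of_pos (gramIn_pos g (mem_extChartAt_source _)))
  refine h1.congr_of_eventuallyEq ?_
  filter_upwards [extChartAt_source_mem_nhds (I := cotangentModel n) z₀] with z hz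
  exact dualForm_gram g (mem_cotangent_chart_source.1 hz) (covec z)

lemma contMDiff_hamiltonian {φ : N → ℝ} (hφ : ContMDiff (𝓡 n) 𝓘(ℝ, ℝ) ∞ φ) :
    ContMDiff (cotangentModel n) 𝓘(ℝ, ℝ) ∞ (hamiltonian g φ) :=
  (hφ.comp contMDiff_cotangent_proj).mul (contMDiff_conormSq g)

end Gram

/-! ### The regularized Hamiltonian and its smoothness -/

section Regularized

variable {n : ℕ} {M : Type*} [TopologicalSpace M] [ChartedSpace (ES n) M] [IsManifold (𝓡 n) ∞ M]
  (g : Bundle.ContMDiffRiemannianMetric (𝓡 n) ∞ (ES n) (fun x : M => TangentSpace (𝓡 n) x))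
  {φ : M → ℝ} [ChartedSpace (ES n) (regularized φ)] {v : regularized φ → ES n}

/-- The regularized covector `ξ p + p(v) dφ` at `π(y)`. -/
def regCovec (v : regularized φ → ES n) (z : Cotangent n (regularized φ)) : ES n →L[ℝ] ℝ :=
  z.proj.1.2 • covec z + covec z (v z.proj) • dphi φ z.proj.1.1

/-- The regularized Hamiltonian `Ĥ`. -/
def regHamiltonian (v : regularized φ → ES n) (z : Cotangent n (regularized φ)) : ℝ :=
  dualForm (gram g z.proj.1.1) (regCovec v z) / 2

namespace AdaptedCharts

variable (h : AdaptedCharts φ v)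
include h

/-- The vector `v` in the definition of `regCovec` varies with the base point and need not be
continuous: it vanishes off `Γ̂` but not on it. In the chart at a fixed `y₀` the same formula holds
with the constant vector `v y₀`, which makes smoothness visible. The reason is that the lift of `w`
has the meaning `(ξ w, dφ(w))` independently of charts. -/
lemma regCovec_comp_dchartSymm [IsManifold (𝓡 n) ∞ (regularized φ)]
    (hφ : ContMDiff (𝓡 n) 𝓘(ℝ, ℝ) ∞ φ) {y₀ : regularized φ} {z : Cotangent n (regularized φ)}
    (hz : z.proj ∈ (extChartAt (𝓡 n) y₀).source) :
    (regCovec v z).comp (dchartSymm y₀.1.1 z.proj.1.1) =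
      xi φ z.proj • (covec z).comp (dchartSymm y₀ z.proj) +
        (covec z).comp (dchartSymm y₀ z.proj) (v y₀) •
          (dphi φ z.proj.1.1).comp (dchartSymm y₀.1.1 z.proj.1.1) := by
  ext1 b
  set w := dchartSymm y₀.1.1 z.proj.1.1 b
  obtain ⟨h1, h2⟩ := h.dproj_dxi_lift hφ z.proj w
  have h3 := h.dchart_apply hz (z.proj.1.2 • w + dphi φ z.proj.1.1 w • v z.proj)
  rw [h1, h2, map_smul, dchart_dchartSymm (h.mem_source y₀ _ hz)] at h3
  have h4 := congrArg (fun a => covec z (dchartSymm y₀ z.proj a)) h3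
  simp only [dchartSymm_dchart hz, map_add, map_smul] at h4
  change z.proj.1.2 • covec z w + covec z (v z.proj) • dphi φ z.proj.1.1 w =
    z.proj.1.2 • covec z (dchartSymm y₀ z.proj b) +
      covec z (dchartSymm y₀ z.proj (v y₀)) • dphi φ z.proj.1.1 w
  simp only [smul_eq_mul] at h4 ⊢
  linarith

lemma contMDiff_regHamiltonian [IsManifold (𝓡 n) ∞ (regularized φ)]
    (hφ : ContMDiff (𝓡 n) 𝓘(ℝ, ℝ) ∞ φ) :
    ContMDiff (cotangentModel n) 𝓘(ℝ, ℝ) ∞ (regHamiltonian g v) := by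
  intro z₀
  have hp : ContMDiffAt (cotangentModel n) (𝓡 n) ∞
      (fun z : Cotangent n (regularized φ) => z.proj.1.1) z₀ :=
    (h.contMDiff_proj.comp contMDiff_cotangent_proj) z₀
  have hxi : ContMDiffAt (cotangentModel n) 𝓘(ℝ, ℝ) ∞
      (fun z : Cotangent n (regularized φ) => xi φ z.proj) z₀ :=
    (h.contMDiff_xi.comp contMDiff_cotangent_proj) z₀
  have hP := contMDiffAt_covec_comp_dchartSymm z₀
  have hd : ContMDiffAt (cotangentModel n) 𝓘(ℝ, ES n →L[ℝ] ℝ) ∞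
      (fun z : Cotangent n (regularized φ) =>
        (dphi φ z.proj.1.1).comp (dchartSymm z₀.proj.1.1 z.proj.1.1)) z₀ :=
    (contMDiffAt_dphi_comp_dchartSymm hφ z₀.proj.1.1).comp z₀ hp
  have hPv : ContMDiffAt (cotangentModel n) 𝓘(ℝ, ℝ) ∞
      (fun z : Cotangent n (regularized φ) =>
        (covec z).comp (dchartSymm z₀.proj z.proj) (v z₀.proj)) z₀ :=
    hP.clm_apply contMDiffAt_const
  have hA : ContMDiffAt (cotangentModel n) 𝓘(ℝ, ES n →L[ℝ] ES n →L[ℝ] ℝ) ∞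
      (fun z : Cotangent n (regularized φ) => gramIn g z₀.proj.1.1 z.proj.1.1) z₀ :=
    ContMDiffAt.comp (g := gramIn g z₀.proj.1.1)
      (f := fun z : Cotangent n (regularized φ) => z.proj.1.1) z₀
      (contMDiffAt_gramIn g z₀.proj.1.1) hp
  have h1 := contMDiffAt_dualForm hA ((hxi.smul hP).add (hPv.smul hd))
    (isInvertible_of_pos (gramIn_pos g (mem_extChartAt_source _)))
  refine (h1.div_const 2).congr_of_eventuallyEq ?_
  filter_upwards [extChartAt_source_mem_nhds (I := cotangentModel n) z₀] with z hz
  have hz := mem_cotangent_chart_source.1 hz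
  have h2 := h.regCovec_comp_dchartSymm hφ hz
  change dualForm (gram g z.proj.1.1) (regCovec v z) / 2 = dualForm _ (_ + _) / 2
  rw [dualForm_gram g (h.mem_source z₀.proj _ hz), h2]
  rfl

lemma inverse_dproj {y : regularized φ} (hy : y.1.2 ≠ 0) :
    (dproj φ y).inverse = ContinuousLinearMap.id ℝ (ES n) := by
  rw [h.dproj_eq_id hy, ContinuousLinearMap.inverse_id]

lemma covec_cotangentLift [IsManifold (𝓡 n) ∞ (regularized φ)] {z : Cotangent n (regularized φ)}
    (hz : z.proj.1.2 ≠ 0) : covec (cotangentLift (proj φ) z) = covec z := by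
  change (covec z).comp (dproj φ z.proj).inverse = covec z
  rw [h.inverse_dproj hz, ContinuousLinearMap.comp_id]

/-- Off `Γ̂` the term with `v` disappears, and `½ ξ² = φ`. -/
lemma regHamiltonian_eq [IsManifold (𝓡 n) ∞ (regularized φ)] {z : Cotangent n (regularized φ)}
    (hz : z.proj.1.2 ≠ 0) :
    regHamiltonian g v z = hamiltonian g φ (cotangentLift (proj φ) z) := by
  have h1 : z.proj.1.2 ^ 2 = 2 * φ z.proj.1.1 := z.proj.2
  rw [hamiltonian, conormSq_eq, h.covec_cotangentLift hz, regHamiltonian, regCovec,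
    h.v_eq_zero _ hz, map_zero, zero_smul, add_zero, dualForm_smul, h1]
  change 2 * φ z.proj.1.1 * dualForm (gram g z.proj.1.1) (covec z) / 2 =
    φ z.proj.1.1 * dualForm (gram g z.proj.1.1) (covec z)
  ring

end AdaptedCharts

end Regularized

/-! ### Trajectories off `Γ̂` -/

section Trajectories

variable {n : ℕ} {M : Type*} [TopologicalSpace M] [ChartedSpace (ES n) M] [IsManifold (𝓡 n) ∞ M]
  {φ : M → ℝ} [ChartedSpace (ES n) (regularized φ)] {v : regularized φ → ES n}

lemma isOpen_inter_preimage_of_isTrajectoryOn {N : Type*} [TopologicalSpace N]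
    [ChartedSpace (ES n) N] [IsManifold (𝓡 n) ∞ N] {H : Cotangent n N → ℝ}
    {z : ℝ → Cotangent n N} {J : Set ℝ} (hz : IsTrajectoryOn H z J) {U : Set (Cotangent n N)}
    (hU : IsOpen U) : IsOpen (J ∩ z ⁻¹' U) :=
  ContinuousOn.isOpen_inter_preimage (fun t ht => (hz.2 t ht).continuousWithinAt) hz.1 hU

namespace AdaptedCharts

variable (h : AdaptedCharts φ v)
include h

lemma dchart_eq {y w : regularized φ} (hy : y.1.2 ≠ 0) (hw : w ∈ (extChartAt (𝓡 n) y).source)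
    (hw' : w.1.2 ≠ 0) : dchart (n := n) y w = dchart y.1.1 w.1.1 := by
  ext1 a
  rw [h.dchart_apply hw, h.dproj_eq_id hw', h.v_eq_zero y hy, smul_zero, add_zero]
  rfl

variable [IsManifold (𝓡 n) ∞ (regularized φ)]

lemma dchartSymm_eq {y w : regularized φ} (hy : y.1.2 ≠ 0)
    (hw : w ∈ (extChartAt (𝓡 n) y).source) (hw' : w.1.2 ≠ 0) :
    dchartSymm (n := n) y w = dchartSymm y.1.1 w.1.1 := by
  rw [← ContinuousLinearMap.id_comp (dchartSymm y w),
    ← dchartSymm_comp_dchart (h.mem_source y w hw), ContinuousLinearMap.comp_assoc,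
    ← h.dchart_eq hy hw hw', dchart_comp_dchartSymm hw, ContinuousLinearMap.comp_id]

omit h [ChartedSpace (ES n) M] [IsManifold (𝓡 n) ∞ M] in
lemma isOpen_xi_ne_zero : IsOpen {z : Cotangent n (regularized φ) | z.proj.1.2 ≠ 0} :=
  isOpen_ne.preimage ((continuous_snd.comp continuous_subtype_val).comp
    (FiberBundle.continuous_proj (ES n →L[ℝ] ℝ) _))

/-- Off `Γ̂` the map `Π` is the identity in canonical charts. -/
lemma extChartAt_cotangentLift {z₀ z : Cotangent n (regularized φ)} (h₀ : z₀.proj.1.2 ≠ 0)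
    (hz : z ∈ (extChartAt (cotangentModel n) z₀).source) (hz' : z.proj.1.2 ≠ 0) :
    cotangentLift (proj φ) z ∈
        (extChartAt (cotangentModel n) (cotangentLift (proj φ) z₀)).source ∧
      extChartAt (cotangentModel n) (cotangentLift (proj φ) z₀) (cotangentLift (proj φ) z) =
        extChartAt (cotangentModel n) z₀ z := by
  have hz := mem_cotangent_chart_source.1 hz
  have h1 : (cotangentLift (proj φ) z).proj ∈
      (extChartAt (𝓡 n) (cotangentLift (proj φ) z₀).proj).source := h.mem_source _ _ hz
  refine ⟨mem_cotangent_chart_source.2 h1, ?_⟩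
  rw [extChartAt_cotangent h1, extChartAt_cotangent hz, h.covec_cotangentLift hz',
    h.chart_eq _ _ hz, h.v_eq_zero _ h₀, smul_zero, add_zero, h.dchartSymm_eq h₀ hz hz']
  rfl

/-- In the canonical charts at `z₀` and at `Π(z₀)` the map is the identity near `z₀`, by
`extChartAt_cotangentLift`. -/
lemma hasMFDerivAt_cotangentLift {z₀ : Cotangent n (regularized φ)} (h₀ : z₀.proj.1.2 ≠ 0) :
    HasMFDerivAt (cotangentModel n) (cotangentModel n) (cotangentLift (proj φ)) z₀
      (ContinuousLinearMap.id ℝ (ES n × (ES n →L[ℝ] ℝ))) := by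
  have h1 : ∀ᶠ z in 𝓝 z₀, z ∈ (extChartAt (cotangentModel n) z₀).source ∧ z.proj.1.2 ≠ 0 :=
    Filter.inter_mem (extChartAt_source_mem_nhds z₀) (isOpen_xi_ne_zero.mem_nhds h₀)
  obtain ⟨h2, h3⟩ := h.extChartAt_cotangentLift h₀ (mem_extChartAt_source z₀) h₀
  constructor
  · have h4 : ContinuousAt ((extChartAt (cotangentModel n) (cotangentLift (proj φ) z₀)).symm ∘
        extChartAt (cotangentModel n) z₀) z₀ := by
      refine ContinuousAt.comp ?_ (continuousAt_extChartAt z₀)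
      rw [← h3]
      exact continuousAt_extChartAt_symm _
    refine h4.congr ?_
    filter_upwards [h1] with z hz
    obtain ⟨h5, h6⟩ := h.extChartAt_cotangentLift h₀ hz.1 hz.2
    rw [Function.comp_apply, ← h6, PartialEquiv.left_inv _ h5]
  · rw [ModelWithCorners.range_eq_univ]
    refine hasFDerivWithinAt_univ.2 ?_
    refine HasFDerivAt.congr_of_eventuallyEq (E := ES n × (ES n →L[ℝ] ℝ))
      (F := ES n × (ES n →L[ℝ] ℝ)) (hasFDerivAt_id (𝕜 := ℝ) _) ?_
    have hc := continuousAt_extChartAt_symm (I := cotangentModel n) z₀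
    rw [ContinuousAt, extChartAt_to_inv] at hc
    filter_upwards [hc.eventually h1, extChartAt_target_mem_nhds z₀] with a ha ha'
    rw [writtenInExtChartAt, Function.comp_apply, Function.comp_apply,
      (h.extChartAt_cotangentLift h₀ ha.1 ha.2).2, PartialEquiv.right_inv _ ha']
    rfl

variable (g : Bundle.ContMDiffRiemannianMetric (𝓡 n) ∞ (ES n)
  (fun x : M => TangentSpace (𝓡 n) x))

lemma dham_regHamiltonian (hφ : ContMDiff (𝓡 n) 𝓘(ℝ, ℝ) ∞ φ) {z₀ : Cotangent n (regularized φ)}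
    (h₀ : z₀.proj.1.2 ≠ 0) :
    dham (regHamiltonian g v) z₀ = dham (hamiltonian g φ) (cotangentLift (proj φ) z₀) := by
  have h1 : HasMFDerivAt (cotangentModel n) 𝓘(ℝ, ℝ) (hamiltonian g φ)
      (cotangentLift (proj φ) z₀) (dham (hamiltonian g φ) (cotangentLift (proj φ) z₀)) :=
    ((contMDiff_hamiltonian g hφ _).mdifferentiableAt (by simp)).hasMFDerivAt
  have h2 := (h1.comp z₀ (h.hasMFDerivAt_cotangentLift h₀)).congr_of_eventuallyEq
    (f₁ := regHamiltonian g v) (by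
      filter_upwards [isOpen_xi_ne_zero.mem_nhds h₀] with z hz
      exact h.regHamiltonian_eq g hz)
  exact h2.mfderiv

/-- Off `Γ̂` the map `Π` takes trajectories of `Ĥ` to trajectories of `H`. -/
lemma isTrajectoryOn_cotangentLift (hφ : ContMDiff (𝓡 n) 𝓘(ℝ, ℝ) ∞ φ)
    {z : ℝ → Cotangent n (regularized φ)} {J : Set ℝ}
    (hz : IsTrajectoryOn (regHamiltonian g v) z J) :
    IsTrajectoryOn (hamiltonian g φ) (fun t => cotangentLift (proj φ) (z t))
      (J ∩ {t | (z t).proj.1.2 ≠ 0}) := by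
  have hJ : IsOpen (J ∩ {t | (z t).proj.1.2 ≠ 0}) :=
    isOpen_inter_preimage_of_isTrajectoryOn hz isOpen_xi_ne_zero
  refine ⟨hJ, fun t ht => ?_⟩
  have h1 := (h.hasMFDerivAt_cotangentLift ht.2).comp_hasMFDerivWithinAt t
    ((hz.2 t ht.1).mono (Set.inter_subset_left (t := {t | (z t).proj.1.2 ≠ 0})))
  have h2 : hamVec (dham (hamiltonian g φ) (cotangentLift (proj φ) (z t))) =
      hamVec (dham (regHamiltonian g v) (z t)) := by
    rw [h.dham_regHamiltonian g hφ ht.2]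
  have h3 : HasMFDerivWithinAt 𝓘(ℝ, ℝ) (cotangentModel n)
      (fun t => cotangentLift (proj φ) (z t)) (J ∩ {t | (z t).proj.1.2 ≠ 0}) t
      ((1 : ℝ →L[ℝ] ℝ).smulRight (hamVec (dham (regHamiltonian g v) (z t)))) := h1
  rw [← h2] at h3
  exact h3

end AdaptedCharts

end Trajectories

/-! ### From Hamilton's equations to the geodesic equation -/

section GeodesicFlow

variable {n : ℕ}

/-- The momentum and the velocity of the Hamiltonian flow of a metric are related by `𝒢 ẋ = 2 P`,
where `H(u, 𝒢(u) a) = 𝒢(u)(a, a)`. -/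
lemma metric_velocity {A : ES n →L[ℝ] ES n →L[ℝ] ℝ} (hA : A.IsInvertible)
    (hsymm : ∀ a b, A a b = A b a) {H : ES n × (ES n →L[ℝ] ℝ) → ℝ} {u : ES n} {P : ES n →L[ℝ] ℝ}
    (hH : DifferentiableAt ℝ H (u, P)) (hHA : ∀ a, H (u, A a) = A a a) :
    A (hamVec (fderiv ℝ H (u, P))).1 = (2 : ℝ) • P := by
  obtain ⟨a, rfl⟩ : ∃ a, A a = P := by
    obtain ⟨e, he⟩ := hA
    exact ⟨e.symm P, by rw [← he]; simp⟩
  ext1 b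
  -- Differentiate `H(u, A a) = A a a` in the direction `b`: the left side gives `dH(0, A b)`, which
  -- is `A b` applied to the velocity, and the right side gives `2 A a b`.
  have h1 : HasFDerivAt (fun a : ES n => (u, A a))
      ((0 : ES n →L[ℝ] ES n).prod A) a := (hasFDerivAt_const u a).prodMk A.hasFDerivAt
  have h2 : HasFDerivAt (fun a => H (u, A a)) _ a := hH.hasFDerivAt.comp a h1
  have h3 : HasFDerivAt (fun a => A a a) _ a := A.hasFDerivAt.clm_apply (hasFDerivAt_id a)
  have h4 := congrArg (fun T : ES n →L[ℝ] ℝ => T b)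
    (h2.unique (h3.congr_of_eventuallyEq (Filter.Eventually.of_forall hHA)))
  have h5 : fderiv ℝ H (u, A a) (0, A b) = A a b + A b a := by simpa using h4
  rw [hsymm, apply_hamVec_fst, h5, hsymm b a]
  simp
  ring

/-- The second half of Hamilton's equations for the Hamiltonian of a metric. -/
lemma metric_force {𝒢 : ES n → ES n →L[ℝ] ES n →L[ℝ] ℝ} {u : ES n} (hA : (𝒢 u).IsInvertible)
    (hsymm : ∀ a b, 𝒢 u a b = 𝒢 u b a) (h𝒢 : DifferentiableAt ℝ 𝒢 u)
    {H : ES n × (ES n →L[ℝ] ℝ) → ℝ} {P : ES n →L[ℝ] ℝ}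
    (hH : DifferentiableAt ℝ H (u, P)) (hHA : ∀ᶠ u' in 𝓝 u, ∀ a, H (u', 𝒢 u' a) = 𝒢 u' a a)
    (w : ES n) :
    2 * (hamVec (fderiv ℝ H (u, P))).2 w =
      fderiv ℝ 𝒢 u w (hamVec (fderiv ℝ H (u, P))).1 (hamVec (fderiv ℝ H (u, P))).1 / 2 := by
  have hv := metric_velocity hA hsymm hH hHA.self_of_nhds
  set y := (hamVec (fderiv ℝ H (u, P))).1 with hy
  obtain ⟨a, rfl⟩ : ∃ a, 𝒢 u a = P := by
    obtain ⟨e, he⟩ := hA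
    exact ⟨e.symm P, by rw [← he]; simp⟩
  have hya : y = (2 : ℝ) • a := by
    obtain ⟨e, he⟩ := hA
    apply e.injective
    change (e : ES n →L[ℝ] ES n →L[ℝ] ℝ) y = (e : ES n →L[ℝ] ES n →L[ℝ] ℝ) ((2 : ℝ) • a)
    rw [he, hv, map_smul]
  -- Keep `a` fixed and differentiate `H(u, 𝒢(u) a) = 𝒢(u)(a, a)` in the direction `w`. The fibre
  -- part contributes `(∂_w 𝒢)(a, ẋ)` with `ẋ = 2a`, so `∂H/∂u (w) = -(∂_w 𝒢)(a, a)`. In terms of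
  -- `ẋ` this reads `Ṗ(w) = ¼ (∂_w 𝒢)(ẋ, ẋ)`.
  have h0 : HasFDerivAt (fun u => 𝒢 u a) ((fderiv ℝ 𝒢 u).flip a) u := by
    simpa using h𝒢.hasFDerivAt.clm_apply (hasFDerivAt_const a u)
  have h1 : HasFDerivAt (fun u => (u, 𝒢 u a))
      ((ContinuousLinearMap.id ℝ (ES n)).prod ((fderiv ℝ 𝒢 u).flip a)) u :=
    (hasFDerivAt_id u).prodMk h0
  have h2 : HasFDerivAt (fun u => H (u, 𝒢 u a)) _ u :=
    HasFDerivAt.comp (g := H) (f := fun u => (u, 𝒢 u a)) u hH.hasFDerivAt h1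
  have h3 : HasFDerivAt (fun u => 𝒢 u a a) _ u := h0.clm_apply (hasFDerivAt_const a u)
  have h4 := congrArg (fun T : ES n →L[ℝ] ℝ => T w)
    (h2.unique (h3.congr_of_eventuallyEq (hHA.mono fun u' hu' => hu' a)))
  have h5 : fderiv ℝ H (u, 𝒢 u a) (w, fderiv ℝ 𝒢 u w a) = fderiv ℝ 𝒢 u w a a := by
    simpa using h4
  have h6 : ((w, fderiv ℝ 𝒢 u w a) : ES n × (ES n →L[ℝ] ℝ)) = (w, 0) + (0, fderiv ℝ 𝒢 u w a) := by
    simp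
  rw [h6, map_add, ← apply_hamVec_fst, ← hy] at h5
  rw [hamVec_snd_apply]
  rw [hya] at h5 ⊢
  simp only [map_smul, smul_apply, smul_eq_mul] at h5 ⊢
  linarith

/-- Bootstrapping: if `W` is of class `C^k`, then so is its derivative `X ∘ W`, and `W` is of class
`C^(k+1)`. -/
lemma contDiffOn_of_hasDerivAt {E : Type*} [NormedAddCommGroup E] [NormedSpace ℝ E] {W : ℝ → E}
    {S : Set ℝ} (hS : IsOpen S) {X : E → E} {T : Set E} (hX : ContDiffOn ℝ ∞ X T)
    (hW : ∀ s ∈ S, HasDerivAt W (X (W s)) s) (hm : Set.MapsTo W S T) (k : ℕ) :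
    ContDiffOn ℝ k W S := by
  induction k with
  | zero =>
    exact contDiffOn_zero.2 fun s hs => (hW s hs).continuousAt.continuousWithinAt
  | succ k ih =>
    push_cast
    rw [contDiffOn_succ_iff_deriv_of_isOpen hS]
    refine ⟨fun s hs => (hW s hs).differentiableAt.differentiableWithinAt, by simp, ?_⟩
    refine ContDiffOn.congr ((hX.of_le ?_).comp ih hm) fun s hs => (hW s hs).deriv
    exact_mod_cast le_top

lemma contDiff_hamVec : ContDiff ℝ ∞ (hamVec (n := n)) := by
  have h : IsLinearMap ℝ (hamVec (n := n)) := by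
    constructor
    · intro D D'
      refine Prod.ext ?_ ?_
      · ext i; simp [hamVec]
      · ext1 a; simp [hamVec_snd_apply]; ring
    · intro c D
      refine Prod.ext ?_ ?_
      · ext i; simp [hamVec]
      · ext1 a; simp [hamVec_snd_apply]
  exact ContinuousLinearMap.contDiff (𝕜 := ℝ) (E := (ES n × (ES n →L[ℝ] ℝ)) →L[ℝ] ℝ)
    (F := ES n × (ES n →L[ℝ] ℝ)) (LinearMap.toContinuousLinearMap (𝕜 := ℝ) (E := (ES n × (ES n →L[ℝ] ℝ)) →L[ℝ] ℝ)
    (F' := ES n × (ES n →L[ℝ] ℝ)) h.mk')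

variable {N : Type*} [TopologicalSpace N] [ChartedSpace (ES n) N] [IsManifold (𝓡 n) ∞ N]
  (g : Bundle.ContMDiffRiemannianMetric (𝓡 n) ∞ (ES n) (fun x : N => TangentSpace (𝓡 n) x))
  {φ : N → ℝ}

/-- The coefficients of `G = g / φ` in the preferred chart at `x₀`. -/
def conformalGram (φ : N → ℝ) (x₀ : N) (u : ES n) : ES n →L[ℝ] ES n →L[ℝ] ℝ :=
  (φ ((extChartAt (𝓡 n) x₀).symm u))⁻¹ • gramIn g x₀ ((extChartAt (𝓡 n) x₀).symm u)

lemma metricInChart_eq {x₀ : N} {u : ES n} (hu : u ∈ (extChartAt (𝓡 n) x₀).target) (a b : ES n) :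
    metricInChart (conformalMetric g φ) x₀ a b u = conformalGram g φ x₀ u a b := by
  have h1 : (mfderiv 𝓘(ℝ, ES n) (𝓡 n) (extChartAt (𝓡 n) x₀).symm u : ES n →L[ℝ] ES n) =
      dchartSymm x₀ ((extChartAt (𝓡 n) x₀).symm u) := by
    rw [dchartSymm, (extChartAt (𝓡 n) x₀).right_inv hu]
  have h2 : metricInChart (conformalMetric g φ) x₀ a b u =
      (φ ((extChartAt (𝓡 n) x₀).symm u))⁻¹ * gram g ((extChartAt (𝓡 n) x₀).symm u)
        ((mfderiv 𝓘(ℝ, ES n) (𝓡 n) (extChartAt (𝓡 n) x₀).symm u : ES n →L[ℝ] ES n) a)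
        ((mfderiv 𝓘(ℝ, ES n) (𝓡 n) (extChartAt (𝓡 n) x₀).symm u : ES n →L[ℝ] ES n) b) := rfl
  rw [h2, h1]
  rfl

lemma conformalGram_symm (x₀ : N) (u a b : ES n) :
    conformalGram g φ x₀ u a b = conformalGram g φ x₀ u b a :=
  congrArg (_ * ·) (gram_symm g _ _ _)

lemma conformalGram_isInvertible {x₀ : N} {u : ES n} (hu : u ∈ (extChartAt (𝓡 n) x₀).target)
    (hφu : 0 < φ ((extChartAt (𝓡 n) x₀).symm u)) : (conformalGram g φ x₀ u).IsInvertible :=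
  isInvertible_of_pos fun a ha => mul_pos (inv_pos.2 hφu)
    (gramIn_pos g ((extChartAt (𝓡 n) x₀).map_target hu) a ha)

lemma differentiableAt_smul {E F : Type*} [NormedAddCommGroup E] [NormedSpace ℝ E]
    [NormedAddCommGroup F] [NormedSpace ℝ F] {c : E → ℝ} {f : E → F} {x : E}
    (hc : DifferentiableAt ℝ c x) (hf : DifferentiableAt ℝ f x) :
    DifferentiableAt ℝ (fun y => c y • f y) x := hc.smul hf

lemma differentiableAt_conformalGram (hφ : ContMDiff (𝓡 n) 𝓘(ℝ, ℝ) ∞ φ) {x₀ : N}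
    (hφx : φ x₀ ≠ 0) :
    DifferentiableAt ℝ (conformalGram g φ x₀) (extChartAt (𝓡 n) x₀ x₀) := by
  have hs : ContMDiffAt 𝓘(ℝ, ES n) (𝓡 n) ∞ (extChartAt (𝓡 n) x₀).symm (extChartAt (𝓡 n) x₀ x₀) :=
    (contMDiffOn_extChartAt_symm x₀).contMDiffAt (extChartAt_target_mem_nhds x₀)
  have h1 : ContMDiffAt 𝓘(ℝ, ES n) 𝓘(ℝ, ES n →L[ℝ] ES n →L[ℝ] ℝ) ∞
      (gramIn g x₀ ∘ (extChartAt (𝓡 n) x₀).symm) (extChartAt (𝓡 n) x₀ x₀) := by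
    refine ContMDiffAt.comp _ ?_ hs
    rw [extChartAt_to_inv]
    exact contMDiffAt_gramIn g x₀
  have h2 : DifferentiableAt ℝ (φ ∘ (extChartAt (𝓡 n) x₀).symm) (extChartAt (𝓡 n) x₀ x₀) :=
    ((hφ _).comp _ hs).contDiffAt.differentiableAt (by simp)
  have h3 : DifferentiableAt ℝ (gramIn g x₀ ∘ (extChartAt (𝓡 n) x₀).symm)
      (extChartAt (𝓡 n) x₀ x₀) := h1.contDiffAt.differentiableAt (by simp)
  have h4 : (φ ∘ (extChartAt (𝓡 n) x₀).symm) (extChartAt (𝓡 n) x₀ x₀) ≠ 0 := by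
    rwa [Function.comp_apply, extChartAt_to_inv]
  exact differentiableAt_smul (F := ES n →L[ℝ] ES n →L[ℝ] ℝ) (h2.inv h4) h3

/-- This says that `H` is the form dual to `G`: the covector is `φ⁻¹ g(a, ·)`, and `φ · (φ⁻¹)² =
φ⁻¹`. -/
lemma hamiltonian_conformalGram {z₀ : Cotangent n N} {u : ES n}
    (hu : u ∈ (extChartAt (𝓡 n) z₀.proj).target)
    (hφu : φ ((extChartAt (𝓡 n) z₀.proj).symm u) ≠ 0) (a : ES n) :
    (hamiltonian g φ ∘ (extChartAt (cotangentModel n) z₀).symm)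
      (u, conformalGram g φ z₀.proj u a) = conformalGram g φ z₀.proj u a a := by
  have hx := (extChartAt (𝓡 n) z₀.proj).map_target hu
  set x := (extChartAt (𝓡 n) z₀.proj).symm u with hx'
  rw [Function.comp_apply, extChartAt_cotangent_symm (by exact hu)]
  change φ x * dualForm (gram g x)
    ((conformalGram g φ z₀.proj u a).comp (dchart z₀.proj x)) = _
  rw [dualForm_gram g hx, ContinuousLinearMap.comp_assoc, dchart_comp_dchartSymm hx,
    ContinuousLinearMap.comp_id]
  have h1 : conformalGram g φ z₀.proj u a = (φ x)⁻¹ • gramIn g z₀.proj x a := rfl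
  rw [h1, dualForm_smul, dualForm_eq (isInvertible_of_pos (gramIn_pos g hx))]
  change _ = (φ x)⁻¹ * gramIn g z₀.proj x a a
  field_simp

lemma contDiffOn_comp_extChartAt_cotangent_symm {H : Cotangent n N → ℝ}
    (hH : ContMDiff (cotangentModel n) 𝓘(ℝ, ℝ) ∞ H) (z₀ : Cotangent n N) :
    ContDiffOn ℝ ∞ (H ∘ (extChartAt (cotangentModel n) z₀).symm)
      (extChartAt (cotangentModel n) z₀).target :=
  contMDiffOn_iff_contDiffOn.1 (hH.comp_contMDiffOn (contMDiffOn_extChartAt_symm z₀))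

/-- Trajectories of `H = φ ‖p‖²` over `{φ > 0}` project to geodesics of `G = g / φ`. -/
theorem isGeodesicOn_of_isTrajectoryOn (hφ : ContMDiff (𝓡 n) 𝓘(ℝ, ℝ) ∞ φ)
    {z : ℝ → Cotangent n N} {J : Set ℝ} (hz : IsTrajectoryOn (hamiltonian g φ) z J)
    (hpos : ∀ t ∈ J, 0 < φ (z t).proj) :
    IsGeodesicOn (conformalMetric g φ) (fun t => (z t).proj) J := by
  have hH := contMDiff_hamiltonian g hφ
  -- Near each time the whole trajectory is read in the chart at `z t`, where it solves a smooth
  -- ordinary differential equation and so is of class `C²`.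
  have key : ∀ t ∈ J, ∃ S : Set ℝ, IsOpen S ∧ t ∈ S ∧ S ⊆ J ∧
      (∀ s ∈ S, (z s).proj ∈ (extChartAt (𝓡 n) (z t).proj).source) ∧
      (∀ s ∈ S, HasDerivAt (fun s => extChartAt (cotangentModel n) (z t) (z s))
        (hamVec (fderiv ℝ (hamiltonian g φ ∘ (extChartAt (cotangentModel n) (z t)).symm)
          (extChartAt (cotangentModel n) (z t) (z s)))) s) ∧
      ContDiffOn ℝ 2 (fun s => extChartAt (cotangentModel n) (z t) (z s)) S := by
    intro t ht
    set S := J ∩ z ⁻¹' (extChartAt (cotangentModel n) (z t)).source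
    have hS : IsOpen S := isOpen_inter_preimage_of_isTrajectoryOn hz (isOpen_extChartAt_source _)
    have hd : ∀ s ∈ S, HasDerivAt (fun s => extChartAt (cotangentModel n) (z t) (z s))
        (hamVec (fderiv ℝ (hamiltonian g φ ∘ (extChartAt (cotangentModel n) (z t)).symm)
          (extChartAt (cotangentModel n) (z t) (z s)))) s := fun s hs =>
      hz.hasDerivAt_extChartAt (hH.mdifferentiable (by simp)) hs.1
        (mem_cotangent_chart_source.1 hs.2)
    refine ⟨S, hS, ⟨ht, mem_extChartAt_source _⟩, Set.inter_subset_left,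
      fun s hs => mem_cotangent_chart_source.1 hs.2, hd, ?_⟩
    refine contDiffOn_of_hasDerivAt hS (T := (extChartAt (cotangentModel n) (z t)).target)
      (contDiff_hamVec.comp_contDiffOn
        ((contDiffOn_comp_extChartAt_cotangent_symm hH (z t)).fderiv_of_isOpen
          (isOpen_extChartAt_target _) (by simp))) hd
      (fun s hs => (extChartAt (cotangentModel n) (z t)).map_source hs.2) 2
  refine ⟨hz.1, ?_, ?_⟩
  · intro t ht
    obtain ⟨S, hS, htS, -, hsrc, -, hC⟩ := key t ht
    have h1 : ContDiffAt ℝ 2 (fun s => (extChartAt (cotangentModel n) (z t) (z s)).1) t :=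
      contDiffAt_fst.comp t (hC.contDiffAt (hS.mem_nhds htS))
    have h2 : ContMDiffAt 𝓘(ℝ, ℝ) (𝓡 n) 2
        ((extChartAt (𝓡 n) (z t).proj).symm ∘
          fun s => (extChartAt (cotangentModel n) (z t) (z s)).1) t := by
      refine ContMDiffAt.comp t ?_ h1.contMDiffAt
      rw [extChartAt_cotangent_self]
      exact ((contMDiffOn_extChartAt_symm (I := 𝓡 n) (n := ∞) (z t).proj).contMDiffAt
        (extChartAt_target_mem_nhds (z t).proj)).of_le (WithTop.coe_le_coe.2 le_top)
    refine (h2.congr_of_eventuallyEq ?_).contMDiffWithinAt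
    filter_upwards [hS.mem_nhds htS] with s hs
    rw [Function.comp_apply, extChartAt_cotangent (hsrc s hs),
      (extChartAt (𝓡 n) (z t).proj).left_inv (hsrc s hs)]
  · intro t ht w
    obtain ⟨S, hS, htS, hSJ, hsrc, hd, hC⟩ := key t ht
    set Hl := hamiltonian g φ ∘ (extChartAt (cotangentModel n) (z t)).symm with hHl
    set W := fun s => extChartAt (cotangentModel n) (z t) (z s) with hW
    set x := fun s => extChartAt (𝓡 n) (z t).proj (z s).proj with hx
    set 𝒢 := conformalGram g φ (z t).proj with h𝒢
    have hW1 : ∀ s ∈ S, (W s).1 = x s := fun s hs => by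
      rw [hW]; dsimp only; rw [extChartAt_cotangent (hsrc s hs)]
    have hxt : ∀ s ∈ S, x s ∈ (extChartAt (𝓡 n) (z t).proj).target := fun s hs =>
      (extChartAt (𝓡 n) (z t).proj).map_source (hsrc s hs)
    have hinv : ∀ s ∈ S, (extChartAt (𝓡 n) (z t).proj).symm (x s) = (z s).proj := fun s hs =>
      (extChartAt (𝓡 n) (z t).proj).left_inv (hsrc s hs)
    have hHd : ∀ s ∈ S, DifferentiableAt ℝ Hl (W s) := fun s hs =>
      ((contDiffOn_comp_extChartAt_cotangent_symm hH (z t)).contDiffAt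
        ((isOpen_extChartAt_target (z t)).mem_nhds ((extChartAt (cotangentModel n) (z t)).map_source
          (mem_cotangent_chart_source.2 (hsrc s hs))))).differentiableAt (by simp)
    have hxd : ∀ s ∈ S, HasDerivAt x (hamVec (fderiv ℝ Hl (W s))).1 s := fun s hs =>
      ((hasFDerivAt_fst (p := W s)).comp_hasDerivAt s (hd s hs)).congr_of_eventuallyEq (by
        filter_upwards [hS.mem_nhds hs] with s' hs'
        exact (hW1 s' hs').symm)
    have hPd : HasDerivAt (fun s => (W s).2) (hamVec (fderiv ℝ Hl (W t))).2 t :=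
      (hasFDerivAt_snd (p := W t)).comp_hasDerivAt t (hd t htS)
    have hvel : ∀ s ∈ S, 𝒢 (x s) (deriv x s) = (2 : ℝ) • (W s).2 := fun s hs => by
      have hpair : W s = (x s, (W s).2) := Prod.ext (hW1 s hs) rfl
      have hs' : 0 < φ ((extChartAt (𝓡 n) (z t).proj).symm (x s)) := by
        rw [hinv s hs]
        exact hpos s (hSJ hs)
      rw [(hxd s hs).deriv, hpair]
      exact metric_velocity (conformalGram_isInvertible g (hxt s hs) hs')
        (conformalGram_symm g _ _) (hpair ▸ hHd s hs)
        (hamiltonian_conformalGram g (hxt s hs) hs'.ne')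
    have hacc : HasDerivAt (deriv x) (deriv (deriv x) t) t := by
      have h1 : ContDiffOn ℝ 2 x S := (contDiff_fst.comp_contDiffOn hC).congr
        fun s hs => (hW1 s hs).symm
      have h2 := (contDiffOn_succ_iff_deriv_of_isOpen (n := 1) hS).1 h1
      exact ((h2.2.2.contDiffAt (hS.mem_nhds htS)).differentiableAt (by simp)).hasDerivAt
    have hpos' : 0 < φ ((extChartAt (𝓡 n) (z t).proj).symm (x t)) := by
      rw [hinv t htS]
      exact hpos t ht
    have h𝒢d : DifferentiableAt ℝ 𝒢 (x t) :=
      differentiableAt_conformalGram g hφ (hpos t ht).ne'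
    have htarget : ∀ᶠ u in 𝓝 (x t), u ∈ (extChartAt (𝓡 n) (z t).proj).target :=
      (isOpen_extChartAt_target _).mem_nhds (hxt t htS)
    have hφu : ∀ᶠ u in 𝓝 (x t), φ ((extChartAt (𝓡 n) (z t).proj).symm u) ≠ 0 :=
      ((hφ.continuous.continuousAt).comp
        (continuousAt_extChartAt_symm (I := 𝓡 n) (z t).proj)).eventually_ne hpos'.ne'
    have hforce : 2 * (hamVec (fderiv ℝ Hl (W t))).2 w =
        fderiv ℝ 𝒢 (x t) w (deriv x t) (deriv x t) / 2 := by
      have hpair : W t = (x t, (W t).2) := Prod.ext (hW1 t htS) rfl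
      rw [(hxd t htS).deriv, hpair]
      refine metric_force (conformalGram_isInvertible g (hxt t htS) hpos')
        (conformalGram_symm g _ _) h𝒢d (hpair ▸ hHd t htS) ?_ w
      filter_upwards [htarget, hφu] with u hu hu'
      exact hamiltonian_conformalGram g hu hu'
    -- Differentiating `𝒢 ẋ = 2P` at `t` and inserting the force equation gives `(∂_ẋ 𝒢)(ẋ, w) +
    -- 𝒢(ẍ, w) = ½ (∂_w 𝒢)(ẋ, ẋ)`, the geodesic equation paired with `w`.
    have h1 : HasDerivAt (fun s => 𝒢 (x s)) (fderiv ℝ 𝒢 (x t) (deriv x t)) t :=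
      HasFDerivAt.comp_hasDerivAt (l := 𝒢) t h𝒢d.hasFDerivAt
        ((hxd t htS).differentiableAt.hasDerivAt)
    have h2 := (h1.clm_apply hacc).congr_of_eventuallyEq (f₁ := fun s => (2 : ℝ) • (W s).2) (by
      filter_upwards [hS.mem_nhds htS] with s hs
      exact (hvel s hs).symm)
    have h3 := congrArg (fun T : ES n →L[ℝ] ℝ => T w) (h2.unique (hPd.const_smul (2 : ℝ)))
    have h4 : fderiv ℝ 𝒢 (x t) (deriv x t) (deriv x t) w + 𝒢 (x t) (deriv (deriv x) t) w =
        2 * (hamVec (fderiv ℝ Hl (W t))).2 w := h3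
    have h5 : ∀ a b c, fderiv ℝ (metricInChart (conformalMetric g φ) (z t).proj a b) (x t) c =
        fderiv ℝ 𝒢 (x t) c a b := by
      intro a b c
      have h6 : HasFDerivAt (fun u => 𝒢 u a b) _ (x t) :=
        (h𝒢d.hasFDerivAt.clm_apply (hasFDerivAt_const a _)).clm_apply (hasFDerivAt_const b _)
      have h7 := h6.congr_of_eventuallyEq
        (f₁ := metricInChart (conformalMetric g φ) (z t).proj a b) (by
          filter_upwards [htarget] with u hu
          exact metricInChart_eq g hu a b)
      rw [h7.fderiv]
      simp
    change metricInChart (conformalMetric g φ) (z t).proj (deriv (deriv x) t) w (x t) +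
      christoffelFirst (conformalMetric g φ) (z t).proj (deriv x t) (deriv x t) w (x t) = 0
    rw [metricInChart_eq g (hxt t htS), christoffelFirst, h5, h5]
    linarith

end GeodesicFlow

/-! ### Derivatives along the fibres -/

section Fibre

variable {n : ℕ} {N : Type*} [TopologicalSpace N] [ChartedSpace (ES n) N] [IsManifold (𝓡 n) ∞ N]

lemma hasMFDerivAt_cotangent_proj (z : Cotangent n N) :
    HasMFDerivAt (cotangentModel n) (𝓡 n) (fun z : Cotangent n N => z.proj) z
      (ContinuousLinearMap.fst ℝ (ES n) (ES n →L[ℝ] ℝ)) := by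
  refine ⟨(contMDiff_cotangent_proj z).continuousAt, ?_⟩
  rw [ModelWithCorners.range_eq_univ]
  refine hasFDerivWithinAt_univ.2 ?_
  refine HasFDerivAt.congr_of_eventuallyEq (E := ES n × (ES n →L[ℝ] ℝ)) (F := ES n)
    (hasFDerivAt_fst (𝕜 := ℝ)) ?_
  filter_upwards [extChartAt_target_mem_nhds z] with a ha
  have ha := mem_cotangent_chart_target.1 ha
  rw [writtenInExtChartAt, Function.comp_apply, Function.comp_apply, extChartAt_cotangent_symm ha]
  exact (extChartAt (𝓡 n) z.proj).right_inv ha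

lemma ofCoords_extChartAt_self (x : N) (Q : ES n →L[ℝ] ℝ) :
    ofCoords x (extChartAt (𝓡 n) x x, Q) = (⟨x, Q⟩ : Cotangent n N) := by
  have h1 : ∀ x' : N, x' = x →
      (⟨x', (Q.comp (dchart x x') : ES n →L[ℝ] ℝ)⟩ : Cotangent n N) = ⟨x, Q⟩ := by
    rintro x' rfl
    rw [dchart_self]
    rfl
  exact h1 _ (extChartAt_to_inv x)

/-- The differential in fibre directions is the derivative along lines in the fibre. -/
lemma hasDerivAt_fibre {H : Cotangent n N → ℝ} (hH : ContMDiff (cotangentModel n) 𝓘(ℝ, ℝ) ∞ H)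
    (z : Cotangent n N) (q : ES n →L[ℝ] ℝ) :
    HasDerivAt (fun t : ℝ => H (⟨z.proj, covec z + t • q⟩ : Cotangent n N))
      (dham H z (0, q)) 0 := by
  have h1 : HasFDerivAt (E := ES n × (ES n →L[ℝ] ℝ)) (F := ℝ)
      (H ∘ (extChartAt (cotangentModel n) z).symm) (dham H z)
      (extChartAt (cotangentModel n) z z) :=
    hasFDerivAt_comp_extChartAt_symm ((hH z).mdifferentiableAt (by simp))
  have h2 : HasDerivAt (fun t : ℝ => (extChartAt (𝓡 n) z.proj z.proj, covec z + t • q))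
      ((0 : ES n), q) 0 := by
    refine (hasDerivAt_const _ _).prodMk ?_
    simpa using ((hasDerivAt_id (0 : ℝ)).smul_const q).const_add (covec z)
  have h3 := HasFDerivAt.comp_hasDerivAt (f := fun t : ℝ =>
      (extChartAt (𝓡 n) z.proj z.proj, covec z + t • q)) (0 : ℝ)
    (l := H ∘ (extChartAt (cotangentModel n) z).symm) (l' := dham H z) (by
      rw [zero_smul, add_zero, ← extChartAt_cotangent_self]; exact h1) h2
  refine h3.congr_of_eventuallyEq (Filter.Eventually.of_forall fun t => ?_)
  simp only [Function.comp_apply]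
  rw [extChartAt_cotangent_symm (mem_extChartAt_target z.proj), ofCoords_extChartAt_self]

end Fibre

/-! ### Regularity of the levels and transversality -/

section Transversality

variable {n : ℕ} {M : Type*} [TopologicalSpace M] [ChartedSpace (ES n) M] [IsManifold (𝓡 n) ∞ M]
  (g : Bundle.ContMDiffRiemannianMetric (𝓡 n) ∞ (ES n) (fun x : M => TangentSpace (𝓡 n) x))
  {φ : M → ℝ} [ChartedSpace (ES n) (regularized φ)] {v : regularized φ → ES n}

/-- The differential of `(ξ, Ĥ)` on `T*Ω̂`. -/
def dxiHam (φ : M → ℝ) [ChartedSpace (ES n) (regularized φ)]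
    [IsManifold (𝓡 n) ∞ (regularized φ)] (H : Cotangent n (regularized φ) → ℝ) (z : Cotangent n (regularized φ)) :
    (ES n × (ES n →L[ℝ] ℝ)) →L[ℝ] ℝ × ℝ :=
  ((dxi φ z.proj).comp (ContinuousLinearMap.fst ℝ (ES n) (ES n →L[ℝ] ℝ))).prod (dham H z)

namespace AdaptedCharts

variable (h : AdaptedCharts φ v) [IsManifold (𝓡 n) ∞ (regularized φ)]
include h

/-- `regCovec` is linear in the momentum, so along a line in the fibre `Ĥ` is a quadratic
polynomial, and the value is its linear coefficient. -/
lemma dham_regHamiltonian_fibre (hφ : ContMDiff (𝓡 n) 𝓘(ℝ, ℝ) ∞ φ)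
    (z : Cotangent n (regularized φ)) (q : ES n →L[ℝ] ℝ) :
    dham (regHamiltonian g v) z (0, q) =
      (regCovec v z ((gram g z.proj.1.1).inverse (regCovec v ⟨z.proj, q⟩)) +
        regCovec v ⟨z.proj, q⟩ ((gram g z.proj.1.1).inverse (regCovec v z))) / 2 := by
  set G := (gram g z.proj.1.1).inverse
  set P := regCovec v z
  set Q := regCovec v (⟨z.proj, q⟩ : Cotangent n (regularized φ))
  have h1 : ∀ t : ℝ, regHamiltonian g v (⟨z.proj, covec z + t • q⟩ : Cotangent n (regularized φ)) =
      (P (G P) + t * (P (G Q) + Q (G P)) + t ^ 2 * Q (G Q)) / 2 := by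
    intro t
    have h2 : regCovec v (⟨z.proj, covec z + t • q⟩ : Cotangent n (regularized φ)) = P + t • Q := by
      ext1 b
      change z.proj.1.2 * (covec z b + t * q b) +
        (covec z (v z.proj) + t * q (v z.proj)) * dphi φ z.proj.1.1 b =
        (z.proj.1.2 * covec z b + covec z (v z.proj) * dphi φ z.proj.1.1 b) +
          t * (z.proj.1.2 * q b + q (v z.proj) * dphi φ z.proj.1.1 b)
      ring
    rw [regHamiltonian, h2]
    change (P + t • Q) (G (P + t • Q)) / 2 = _
    simp only [map_add, map_smul, add_apply, smul_apply, smul_eq_mul]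
    ring
  have h3 := hasDerivAt_fibre (h.contMDiff_regHamiltonian g hφ) z q
  simp_rw [h1] at h3
  have h4 : HasDerivAt (fun t : ℝ => (P (G P) + t * (P (G Q) + Q (G P)) + t ^ 2 * Q (G Q)) / 2)
      ((P (G Q) + Q (G P)) / 2) 0 := by
    have h5 := (((((hasDerivAt_id (0 : ℝ)).mul_const (P (G Q) + Q (G P))).const_add (P (G P))).add
      (((hasDerivAt_id (0 : ℝ)).pow 2).mul_const (Q (G Q)))).div_const 2)
    refine h5.congr_deriv ?_
    simp
  exact h3.unique h4

/-- Euler's identity for the regularized Hamiltonian. -/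
lemma dham_regHamiltonian_euler (hφ : ContMDiff (𝓡 n) 𝓘(ℝ, ℝ) ∞ φ)
    (z : Cotangent n (regularized φ)) :
    dham (regHamiltonian g v) z (0, covec z) = 2 * regHamiltonian g v z := by
  rw [h.dham_regHamiltonian_fibre g hφ, regHamiltonian, dualForm]
  have h1 : regCovec v (⟨z.proj, covec z⟩ : Cotangent n (regularized φ)) = regCovec v z := rfl
  rw [h1]
  ring

/-- The coordinate `ξ` increases along trajectories crossing `Γ̂`. -/
lemma dxi_hamVec_mul (hφ : ContMDiff (𝓡 n) 𝓘(ℝ, ℝ) ∞ φ) {z : Cotangent n (regularized φ)}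
    (hz : z.proj.1.2 = 0) :
    dxi φ z.proj (hamVec (dham (regHamiltonian g v) z)).1 * covec z (v z.proj) =
      2 * regHamiltonian g v z := by
  -- At `ξ = 0` the regularized covectors of `p` and of `dξ` are `p(v) dφ` and `dφ`. So `ξ̇ = dĤ(0,
  -- dξ) = p(v) ‖dφ‖²`, while `2Ĥ = p(v)² ‖dφ‖²`.
  have h1 : regCovec v z = covec z (v z.proj) • dphi φ z.proj.1.1 := by
    rw [regCovec, hz, zero_smul, zero_add]
  have h2 : regCovec v (⟨z.proj, dxi φ z.proj⟩ : Cotangent n (regularized φ)) =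
      dphi φ z.proj.1.1 := by
    change z.proj.1.2 • _ + dxi φ z.proj (v z.proj) • dphi φ z.proj.1.1 = _
    rw [hz, zero_smul, zero_add, h.dxi_v hφ hz, one_smul]
  rw [apply_hamVec_fst, h.dham_regHamiltonian_fibre g hφ, h2, regHamiltonian, dualForm, h1]
  simp only [map_smul, smul_apply, smul_eq_mul]
  ring

omit [IsManifold (𝓡 n) ∞ M] in
lemma hasMFDerivAt_xi_proj (z : Cotangent n (regularized φ)) :
    HasMFDerivAt (cotangentModel n) 𝓘(ℝ, ℝ) (fun z : Cotangent n (regularized φ) => xi φ z.proj) z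
      ((dxi φ z.proj).comp (ContinuousLinearMap.fst ℝ (ES n) (ES n →L[ℝ] ℝ))) :=
  (h.hasMFDerivAt_xi z.proj).comp z (hasMFDerivAt_cotangent_proj z)

lemma hasMFDerivAt_regHamiltonian (hφ : ContMDiff (𝓡 n) 𝓘(ℝ, ℝ) ∞ φ)
    (z : Cotangent n (regularized φ)) :
    HasMFDerivAt (cotangentModel n) 𝓘(ℝ, ℝ) (regHamiltonian g v) z
      (dham (regHamiltonian g v) z) :=
  ((h.contMDiff_regHamiltonian g hφ z).mdifferentiableAt (by simp)).hasMFDerivAt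

lemma hasMFDerivAt_xi_regHamiltonian (hφ : ContMDiff (𝓡 n) 𝓘(ℝ, ℝ) ∞ φ)
    (z : Cotangent n (regularized φ)) :
    HasMFDerivAt (cotangentModel n) 𝓘(ℝ, ℝ × ℝ)
      (fun z : Cotangent n (regularized φ) => (xi φ z.proj, regHamiltonian g v z)) z
      (dxiHam φ (regHamiltonian g v) z) :=
  ⟨(h.hasMFDerivAt_xi_proj z).1.prodMk (h.hasMFDerivAt_regHamiltonian g hφ z).1,
    HasFDerivWithinAt.prodMk (E := ES n × (ES n →L[ℝ] ℝ)) (F := ℝ) (G := ℝ)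
      (h.hasMFDerivAt_xi_proj z).2 (h.hasMFDerivAt_regHamiltonian g hφ z).2⟩

/-- Transversality of the Hamiltonian flow to the section `S_h` in `{Ĥ = h}`. -/
theorem exists_transverse_section (hφ : ContMDiff (𝓡 n) 𝓘(ℝ, ℝ) ∞ φ) {c : ℝ} (hc : 0 < c) :
    ∃ (_ : ChartedSpace (ES (2 * n - 1)) {z | regHamiltonian g v z = c})
      (_ : ChartedSpace (ES (2 * n - 2)) (poincareSection φ (regHamiltonian g v) c)),
      IsEmbeddedSubmanifold (cotangentModel n) (2 * n - 1) {z | regHamiltonian g v z = c} ∧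
      IsEmbeddedSubmanifold (cotangentModel n) (2 * n - 2)
        (poincareSection φ (regHamiltonian g v) c) ∧
      ∀ (z : Cotangent n (regularized φ)) (hz : z ∈ poincareSection φ (regHamiltonian g v) c),
        hamiltonianField (regHamiltonian g v) z ∉
          submanifoldTangent (cotangentModel n) (2 * n - 2)
            (poincareSection φ (regHamiltonian g v) c) ⟨z, hz⟩ ∧
        submanifoldTangent (cotangentModel n) (2 * n - 2)
            (poincareSection φ (regHamiltonian g v) c) ⟨z, hz⟩ ⊔
            Submodule.span ℝ {hamiltonianField (regHamiltonian g v) z}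
          = submanifoldTangent (cotangentModel n) (2 * n - 1)
              {z | regHamiltonian g v z = c} ⟨z, hz.2⟩ := by
  set H := regHamiltonian g v with hH
  have hHs : ContMDiff (cotangentModel n) 𝓘(ℝ, ℝ) ∞ H := h.contMDiff_regHamiltonian g hφ
  have hdim : Module.finrank ℝ (ES n × (ES n →L[ℝ] ℝ)) = 2 * n := by
    rw [Module.finrank_prod, finrank_covectors, finrank_euclideanSpace_fin, two_mul]
  have heuler : ∀ z, H z = c → dham H z (0, covec z) = 2 * c := fun z hz => by
    rw [h.dham_regHamiltonian_euler g hφ, ← hH, hz]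
  -- The product of `ξ̇` with `p(v)` is `2c`, which is positive, so `ξ̇` cannot vanish.
  have hxiX : ∀ z ∈ poincareSection φ H c, dxi φ z.proj (hamVec (dham H z)).1 ≠ 0 := by
    intro z hz h0
    have h1 := h.dxi_hamVec_mul g hφ (mem_boundary_iff.1 hz.1)
    have h2 : H z = c := hz.2
    rw [← hH, h0, h2, zero_mul] at h1
    linarith
  have hmem : ∀ z, z ∈ poincareSection φ H c ↔ (xi φ z.proj, H z) = (0, c) := fun z => by
    rw [Prod.mk.injEq]
    exact and_congr mem_boundary_iff Iff.rfl
  obtain ⟨c₁, e₁, t₁⟩ := exists_isEmbeddedSubmanifold_of_surjective_mfderiv hHs c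
    (S := {z | H z = c}) (fun x => Iff.rfl)
    (fun z hz => LinearMap.surjective (f := (dham H z).toLinearMap) fun h0 => by
      have h1 : dham H z (0, covec z) = 0 := LinearMap.congr_fun h0 (0, covec z)
      rw [heuler z hz] at h1
      linarith)
    (k := 2 * n - 1) (by rw [hdim, Module.finrank_self])
  have hFs : ContMDiff (cotangentModel n) 𝓘(ℝ, ℝ × ℝ) ∞
      (fun z : Cotangent n (regularized φ) => (xi φ z.proj, H z)) :=
    (h.contMDiff_xi.comp contMDiff_cotangent_proj).prodMk_space hHs
  have hF : ∀ z : Cotangent n (regularized φ), mfderiv (cotangentModel n) 𝓘(ℝ, ℝ × ℝ)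
      (fun z : Cotangent n (regularized φ) => (xi φ z.proj, H z)) z = dxiHam φ H z :=
    fun z => (h.hasMFDerivAt_xi_regHamiltonian g hφ z).mfderiv
  have hFsurj : ∀ z ∈ poincareSection φ H c, Function.Surjective (dxiHam φ H z) := by
    rintro z hz ⟨a, b⟩
    -- The differential of `(ξ, Ĥ)` sends the Hamiltonian vector to `(ξ̇, 0)`, by conservation of
    -- energy, and the vertical vector `(0, p)` to `(0, 2c)`, by Euler's identity.
    refine ⟨(a / dxi φ z.proj (hamVec (dham H z)).1) • hamVec (dham H z) +
      (b / (2 * c)) • ((0 : ES n), covec z), ?_⟩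
    have h1 : dxiHam φ H z (hamVec (dham H z)) = (dxi φ z.proj (hamVec (dham H z)).1, 0) :=
      Prod.ext rfl (apply_hamVec_self _)
    have h2 : dxiHam φ H z ((0 : ES n), covec z) = (0, 2 * c) :=
      Prod.ext (map_zero (dxi φ z.proj)) (heuler z hz.2)
    rw [map_add, map_smul, map_smul, h1, h2]
    have h3 := hxiX z hz
    have h4 : 2 * c ≠ 0 := by positivity
    simp [h3, hc.ne']
  obtain ⟨c₂, e₂, t₂⟩ := exists_isEmbeddedSubmanifold_of_surjective_mfderiv hFs ((0 : ℝ), c)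
    (S := poincareSection φ H c) hmem
    (fun z hz => by
      have h1 := hFsurj z hz
      rw [← hF z] at h1
      exact h1)
    (k := 2 * n - 2) (by rw [hdim, Module.finrank_prod, Module.finrank_self])
  refine ⟨c₁, c₂, e₁, e₂, fun z hz => ?_⟩
  have ht₁ : ∀ Y : ES n × (ES n →L[ℝ] ℝ), Y ∈ submanifoldTangent (cotangentModel n) (2 * n - 1)
      {z | H z = c} ⟨z, hz.2⟩ ↔ dham H z Y = 0 := fun Y => by
    rw [t₁ ⟨z, hz.2⟩]
    exact Iff.rfl
  have ht₂ : ∀ Y : ES n × (ES n →L[ℝ] ℝ), Y ∈ submanifoldTangent (cotangentModel n) (2 * n - 2)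
      (poincareSection φ H c) ⟨z, hz⟩ ↔ dxi φ z.proj Y.1 = 0 ∧ dham H z Y = 0 := fun Y => by
    rw [t₂ ⟨z, hz⟩]
    have h1 : dxiHam φ H z Y = 0 ↔ dxi φ z.proj Y.1 = 0 ∧ dham H z Y = 0 :=
      Prod.mk_eq_zero
    refine Iff.trans ?_ h1
    exact Eq.to_iff (congrArg (fun T : (ES n × (ES n →L[ℝ] ℝ)) →L[ℝ] ℝ × ℝ => T Y = 0) (hF z))
  have hX : dham H z (hamVec (dham H z)) = 0 := apply_hamVec_self _
  refine ⟨fun h0 => hxiX z hz ((ht₂ (hamVec (dham H z))).1 h0).1, le_antisymm ?_ fun Y hY => ?_⟩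
  · refine sup_le (fun Y hY => (ht₁ Y).2 ((ht₂ Y).1 hY).2) ?_
    rw [Submodule.span_singleton_le_iff_mem]
    exact (ht₁ (hamVec (dham H z))).2 hX
  · have hY' := (ht₁ Y).1 hY
    -- Subtracting the multiple `r` of the Hamiltonian vector removes the `dξ`-component of `Y` and
    -- leaves a vector tangent to the section.
    obtain ⟨r, hr⟩ : ∃ r : ℝ, r * dxi φ z.proj (hamVec (dham H z)).1 =
        dxi φ z.proj (show ES n × (ES n →L[ℝ] ℝ) from Y).1 :=
      ⟨_, div_mul_cancel₀ _ (hxiX z hz)⟩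
    refine Submodule.mem_sup.2 ⟨(show ES n × (ES n →L[ℝ] ℝ) from Y) - r • hamVec (dham H z), ?_,
      r • hamVec (dham H z), Submodule.smul_mem _ r (Submodule.mem_span_singleton_self _), ?_⟩
    · refine (ht₂ _).2 ⟨?_, ?_⟩
      · rw [Prod.fst_sub, Prod.smul_fst, map_sub, map_smul, smul_eq_mul, hr, sub_self]
      · rw [map_sub, map_smul, hX, smul_zero, sub_zero]
        exact hY'
    · exact sub_add_cancel (show ES n × (ES n →L[ℝ] ℝ) from Y) (r • hamVec (dham H z))

end AdaptedCharts

end Transversality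

end LeviCivitaRegularization

end

/-! ### The main theorem -/

open LeviCivitaRegularization in
theorem mainTheorem1 {n : ℕ} {M : Type*} [TopologicalSpace M] [T2Space M]
    [SecondCountableTopology M] [ChartedSpace (ES n) M] [IsManifold (𝓡 n) ∞ M]
    (g : Bundle.ContMDiffRiemannianMetric (𝓡 n) ∞ (ES n) (fun x : M => TangentSpace (𝓡 n) x))
    (φ : M → ℝ) (hφ : ContMDiff (𝓡 n) 𝓘(ℝ, ℝ) ∞ φ)
    (hdφ : ∀ x ∈ boundary φ, mfderiv (𝓡 n) 𝓘(ℝ, ℝ) φ x ≠ 0) :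
    -- `Ω̂` is a smooth embedded submanifold of `M × ℝ` of dimension `n`
    ∃ (_ : ChartedSpace (ES n) (regularized φ)) (_ : IsManifold (𝓡 n) ∞ (regularized φ)),
      IsEmbeddedSubmanifold ((𝓡 n).prod 𝓘(ℝ, ℝ)) n (regularized φ) ∧
      -- topologically it is the double of the closure of `Ω` along `Γ`
      (∃ e : Double (closure (domain φ)) (boundary φ) ≃ₜ regularized φ,
        ∀ (x : closure (domain φ)) (b : Bool), proj φ (e (Quotient.mk _ (x, b))) = x) ∧
      -- the projection is smooth, with image the closure of `Ω`
      ContMDiff (𝓡 n) (𝓡 n) ∞ (proj φ) ∧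
      Set.range (proj φ) = closure (domain φ) ∧
      -- it is a smooth double covering over `Ω`
      IsCoveringMapOn (proj φ) (domain φ) ∧
      (∀ x ∈ domain φ, (proj φ ⁻¹' {x}).ncard = 2) ∧
      (∀ y, proj φ y ∈ domain φ → IsLocalDiffeomorphAt (𝓡 n) (𝓡 n) ∞ (proj φ) y) ∧
      -- it restricts to a diffeomorphism of the smooth hypersurfaces `Γ̂` and `Γ`
      (∃ (_ : ChartedSpace (ES (n - 1)) (boundary φ))
        (_ : ChartedSpace (ES (n - 1)) (liftedBoundary φ)),
        IsEmbeddedSubmanifold (𝓡 n) (n - 1) (boundary φ) ∧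
        IsEmbeddedSubmanifold (𝓡 n) (n - 1) (liftedBoundary φ) ∧
        ∃ f : liftedBoundary φ ≃ₘ^∞⟮𝓡 (n - 1), 𝓡 (n - 1)⟯ boundary φ,
          ∀ y, (f y : M) = proj φ y) ∧
      -- over the complement of `Γ̂` the map `Π` is well defined, with values in `T*Ω`
      (∀ y ∉ liftedBoundary φ, proj φ y ∈ domain φ ∧
        (mfderiv (𝓡 n) (𝓡 n) (proj φ) y).IsInvertible) ∧
      -- `H ∘ Π` extends to a smooth function `Ĥ` on `T*Ω̂`
      ∃ Hhat : Cotangent n (regularized φ) → ℝ,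
        ContMDiff (cotangentModel n) 𝓘(ℝ, ℝ) ∞ Hhat ∧
        (∀ z, z.proj ∉ liftedBoundary φ →
          Hhat z = hamiltonian g φ (cotangentLift (proj φ) z)) ∧
        -- `Π` maps trajectories of `Ĥ` to trajectories of `H`, which project to geodesics of `G`
        (∀ (z : ℝ → Cotangent n (regularized φ)) (J : Set ℝ), IsTrajectoryOn Hhat z J →
          IsTrajectoryOn (hamiltonian g φ) (fun t => cotangentLift (proj φ) (z t))
            (J ∩ {t | (z t).proj ∉ liftedBoundary φ}) ∧
          IsGeodesicOn (conformalMetric g φ) (fun t => proj φ (z t).proj)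
            (J ∩ {t | (z t).proj ∉ liftedBoundary φ})) ∧
        -- for `h > 0`, the trajectories cross `S_h` transversely in the hypersurface `{Ĥ = h}`
        ∀ h : ℝ, 0 < h →
          ∃ (_ : ChartedSpace (ES (2 * n - 1)) {z | Hhat z = h})
            (_ : ChartedSpace (ES (2 * n - 2)) (poincareSection φ Hhat h)),
            IsEmbeddedSubmanifold (cotangentModel n) (2 * n - 1) {z | Hhat z = h} ∧
            IsEmbeddedSubmanifold (cotangentModel n) (2 * n - 2) (poincareSection φ Hhat h) ∧
            ∀ (z : Cotangent n (regularized φ)) (hz : z ∈ poincareSection φ Hhat h),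
              hamiltonianField Hhat z ∉
                submanifoldTangent (cotangentModel n) (2 * n - 2)
                  (poincareSection φ Hhat h) ⟨z, hz⟩ ∧
              submanifoldTangent (cotangentModel n) (2 * n - 2)
                  (poincareSection φ Hhat h) ⟨z, hz⟩ ⊔ Submodule.span ℝ {hamiltonianField Hhat z}
                = submanifoldTangent (cotangentModel n) (2 * n - 1)
                    {z | Hhat z = h} ⟨z, hz.2⟩ := by
  obtain ⟨cs, v, h⟩ := exists_adaptedCharts hφ hdφ
  have := h.embedded.isManifold
  have hcl := closure_domain hφ hdφ
  have hΓ : ∀ y : regularized φ, y ∉ liftedBoundary φ ↔ y.1.2 ≠ 0 := fun y =>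
    not_congr mem_boundary_iff
  refine ⟨cs, this, h.embedded, exists_homeomorph_double hφ.continuous hcl, h.contMDiff_proj,
    range_proj.trans hcl.symm, isCoveringMapOn_proj hφ.continuous, fun x hx => ncard_fiber hx,
    fun y hy => h.isLocalDiffeomorphAt_proj (mem_domain_iff.1 hy),
    h.exists_diffeomorph_boundary hφ hdφ, fun y hy => ⟨mem_domain_iff.2 ((hΓ y).1 hy), ?_⟩,
    regHamiltonian g v, h.contMDiff_regHamiltonian g hφ,
    fun z hz => h.regHamiltonian_eq g ((hΓ _).1 hz), fun z J hz => ?_,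
    fun c hc => h.exists_transverse_section g hφ hc⟩
  · exact ⟨ContinuousLinearEquiv.refl ℝ (ES n), (h.dproj_eq_id ((hΓ y).1 hy)).symm⟩
  · have hset : {t | (z t).proj ∉ liftedBoundary φ} = {t | (z t).proj.1.2 ≠ 0} :=
      Set.ext fun t => hΓ _
    have h1 := h.isTrajectoryOn_cotangentLift g hφ hz
    rw [hset]
    exact ⟨h1, isGeodesicOn_of_isTrajectoryOn g hφ h1 fun t ht => mem_domain_iff.2 ht.2⟩
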